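/- **Setting.** Let $\mathbb G$ be a Carnot group: the connected, simply connected nilpotent Lie group whose finite-dimensional real Lie algebra $\mathfrak g$ is stratified, $\mathfrak g=V_1\oplus\dots\oplus V_k$ with $k\ge 1$, $[V_1,V_i]=V_{i+1}$, $V_k\ne\{0\}$ and $V_i=\{0\}$ for $i>k$. Identify $\mathbb G$ with $\mathfrak g$ through the exponential map, so that the group law is given by the Baker–Campbell–Hausdorff formula, and let $dx$ be the Lebesgue (Haar) measure. The dilation $\delta_\lambda$ ($\lambda>0$) acts on $V_i$ as multiplication by $\lambda^i$, and $Q=\sum_{i=1}^k i\dim V_i$ is the homogeneous dimension. Let $\|\cdot\|_{\mathbb G}:\mathbb G\to[0,\infty)$ be a homogeneous norm, i.e. a continuous function with $\|x\|_{\mathbb G}=0\iff x=0$, $\|x^{-1}\|_{\mathbb G}=\|x\|_{\mathbb G}$ and $\|\delta_\lambda x\|_{\mathbb G}=\lambda\|x\|_{\mathbb G}$ for $\lambda>0$, which satisfies the triangle inequality $\big|\|y\|_{\mathbb G}-\|x\|_{\mathbb G}\big|\le\|y^{-1}\cdot x\|_{\mathbb G}\le\|x\|_{\mathbb G}+\|y\|_{\mathbb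 G}$. Let $C_b$ be the measure of the unit ball $\{\|x\|_{\mathbb G}<1\}$. Let $\varphi(t)=\int_0^t\phi(\tau)\,d\tau$ be an Orlicz function, where $\phi:[0,\infty)\to[0,\infty)$ is nondecreasing and right-continuous, $\phi(0)=0$, $\phi(t)>0$ for $t>0$ and $\phi(t)\to\infty$ as $t\to\infty$. Suppose that $$1<p^-\le\frac{t\,\phi(t)}{\varphi(t)}\le p^+<\infty\qquad\text{for all }t>0,$$ and let $\mathbf C$ be the smallest constant such that $\varphi(2t)\le\mathbf C\,\varphi(t)$ for all $t\ge0$. For measurable $u:\mathbb G\to\mathbb R$ and $0<s<1$ put $$\Phi_\varphi(u)=\int_{\mathbb G}\varphi(|u(x)|)\,dx,\qquad \Phi_{s,\varphi}(u)=\iint_{\mathbb G\times\mathbb G}\varphi\!\left(\frac{|u(x)-u(y)|}{\|y^{-1}\cdot x\|_{\mathbb G}^s}\right)\frac{dx\,dy}{\|y^{-1}\cdot x\|_{\mathbb G}^Q},$$ and let $W^{s,\varphi}(\mathbb G)$ be the set of measurable $u$ with $\Phi_\varphi(u)<\infty$ and $\Phi_{s,\varphi}(u)<\infty$. **Theorem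 1.2.** If $u\in\bigcup_{s\in(0,1)}W^{s,\varphi}(\mathbb G)$, then $$\frac{4}{\mathbf C}\,\frac{QC_b}{p^+}\,\Phi_\varphi(u)\le\liminf_{s\downarrow0}s\,\Phi_{s,\varphi}(u)\le\limsup_{s\downarrow0}s\,\Phi_{s,\varphi}(u)\le\mathbf C\,\frac{QC_b}{p^-}\,\Phi_\varphi(u).$$ In particular, if $\lim_{s\downarrow0}s\,\Phi_{s,\varphi}(u)$ exists, then $$\frac{4}{\mathbf C}\,\frac{QC_b}{p^+}\,\Phi_\varphi(u)\le\lim_{s\downarrow0}s\,\Phi_{s,\varphi}(u)\le\mathbf C\,\frac{QC_b}{p^-}\,\Phi_\varphi(u).$$ -/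

import Mathlib

open MeasureTheory Filter Topology
open scoped ENNReal

noncomputable section

/-! ### Carnot groups in exponential coordinates -/

namespace Carnot

section Law

variable {𝔤 : Type*} [LieRing 𝔤]

/-- The right-nested iterated bracket `⁅w₁, ⁅w₂, … ⁅wₘ₋₁, wₘ⁆ … ⁆⁆` of the letters of a word. -/
def nestedBracket : List 𝔤 → 𝔤
  | [] => 0
  | [a] => a
  | a :: b :: l => ⁅a, nestedBracket (b :: l)⁆

/-- The word `x^{r₁} y^{s₁} ⋯ x^{rₖ} y^{sₖ}`, where `p i = (rᵢ, sᵢ)`. -/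
def dynkinWord {k : ℕ} (p : Fin k → ℕ × ℕ) (x y : 𝔤) : List 𝔤 :=
  (List.ofFn fun i => List.replicate (p i).1 x ++ List.replicate (p i).2 y).flatten

/-- The Baker-Campbell-Hausdorff product `log (exp x exp y)` in a real Lie algebra that is
nilpotent of step at most `c`, by Dynkin's formula
`∑ₖ (-1)^{k-1}/k ∑_{rᵢ+sᵢ>0} [x^{r₁}y^{s₁}⋯x^{rₖ}y^{sₖ}] / ((∑ᵢ (rᵢ+sᵢ)) ∏ᵢ rᵢ! sᵢ!)`.
Iterated brackets of more than `c` letters vanish, so `k, rᵢ, sᵢ ≤ c` is no restriction. -/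
def bch [LieAlgebra ℝ 𝔤] (c : ℕ) (x y : 𝔤) : 𝔤 :=
  ∑ k ∈ Finset.Icc 1 c,
    ∑ p ∈ Fintype.piFinset (fun _ : Fin k =>
        (Finset.range (c + 1) ×ˢ Finset.range (c + 1)).erase (0, 0)),
      ((-1 : ℝ) ^ (k - 1) /
        ((k : ℝ) * ((∑ i, ((p i).1 + (p i).2) : ℕ) : ℝ) *
          ((∏ i, ((p i).1.factorial * (p i).2.factorial) : ℕ) : ℝ))) •
        nestedBracket (dynkinWord p x y)

end Law

/-- A stratification `𝔤 = V₁ ⊕ ⋯ ⊕ Vₖ`, `[V₁, Vᵢ] = Vᵢ₊₁`, `Vₖ ≠ 0`, `Vᵢ = 0` for `i > k`,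
of a real Lie algebra. The layers are indexed by `ℕ`, with `V₀ = 0`. -/
structure Stratification (𝔤 : Type*) [LieRing 𝔤] [LieAlgebra ℝ 𝔤] where
  /-- the step `k` -/
  step : ℕ
  /-- the layers `Vᵢ` -/
  layer : ℕ → Submodule ℝ 𝔤
  one_le_step : 1 ≤ step
  isInternal : DirectSum.IsInternal layer
  layer_zero : layer 0 = ⊥
  layer_step_ne_bot : layer step ≠ ⊥
  layer_eq_bot : ∀ i, step < i → layer i = ⊥
  span_bracket : ∀ i, 1 ≤ i →
    Submodule.span ℝ {z : 𝔤 | ∃ x ∈ layer 1, ∃ y ∈ layer i, ⁅x, y⁆ = z} = layer (i + 1)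

namespace Stratification

variable {𝔤 : Type*} [LieRing 𝔤] [LieAlgebra ℝ 𝔤] (S : Stratification 𝔤)

/-- The group law `x · y` of the Carnot group with stratified Lie algebra `𝔤`, in exponential
coordinates (the group is identified with `𝔤` by the exponential map). The identity is `0`
and the inverse of `x` is `-x`. -/
def mul (x y : 𝔤) : 𝔤 := bch S.step x y

/-- The component of `x` in the layer `Vᵢ`. -/
def component (i : ℕ) (x : 𝔤) : 𝔤 :=
  ((LinearEquiv.ofBijective (DirectSum.coeLinearMap S.layer) S.isInternal).symm x i : S.layer i)

/-- The dilation `δ_r`, acting on `Vᵢ` as multiplication by `r ^ i`. -/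
def dilation (r : ℝ) (x : 𝔤) : 𝔤 :=
  ∑ i ∈ Finset.Icc 1 S.step, r ^ i • S.component i x

/-- The homogeneous dimension `Q = ∑ᵢ i dim Vᵢ`. -/
def homDim : ℕ := ∑ i ∈ Finset.Icc 1 S.step, i * Module.finrank ℝ (S.layer i)

/-- A homogeneous norm on the Carnot group that satisfies the triangle inequality. -/
structure HomogeneousNorm [TopologicalSpace 𝔤] where
  /-- the norm as a function -/
  toFun : 𝔤 → ℝ
  continuous' : Continuous toFun
  nonneg' : ∀ x, 0 ≤ toFun x
  eq_zero_iff' : ∀ x, toFun x = 0 ↔ x = 0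
  inv' : ∀ x, toFun (-x) = toFun x
  dilation' : ∀ r : ℝ, 0 < r → ∀ x, toFun (S.dilation r x) = r * toFun x
  abs_sub_le' : ∀ x y, |toFun y - toFun x| ≤ toFun (S.mul (-y) x)
  le_add' : ∀ x y, toFun (S.mul (-y) x) ≤ toFun x + toFun y

end Stratification

end Carnot

/-! ### Orlicz functions -/

/-- The conditions on `a : [0, ∞) → [0, ∞)` for `t ↦ ∫₀ᵗ a` to be an Orlicz function. -/
structure IsOrliczDensity (a : ℝ → ℝ) : Prop where
  zero : a 0 = 0
  pos : ∀ t, 0 < t → 0 < a t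
  mono : MonotoneOn a (Set.Ici 0)
  right_cont : ∀ t, 0 ≤ t → ContinuousWithinAt a (Set.Ici t) t
  tendsto : Tendsto a atTop atTop

/-- The Orlicz function `φ(t) = ∫₀ᵗ a(τ) dτ`, `t ≥ 0`. -/
def orlicz (a : ℝ → ℝ) (t : ℝ) : ℝ := ∫ τ in (0 : ℝ)..t, a τ

/-- The `Δ₂`-constant: the smallest `C > 0` with `φ(2t) ≤ C φ(t)` for all `t ≥ 0`. -/
def delta2Const (φ : ℝ → ℝ) : ℝ :=
  sInf {C : ℝ | 0 < C ∧ ∀ t, 0 ≤ t → φ (2 * t) ≤ C * φ t}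

/-! ### The functionals and the fractional Orlicz-Sobolev space -/

namespace Carnot

variable {𝔤 : Type*} [MeasurableSpace 𝔤]

/-- `Φ_φ(u) = ∫ φ(|u(x)|) dx`, with values in `[0, ∞]`. -/
def orliczModular (μ : Measure 𝔤) (φ : ℝ → ℝ) (u : 𝔤 → ℝ) : ℝ≥0∞ :=
  ∫⁻ x, ENNReal.ofReal (φ |u x|) ∂μ

variable [LieRing 𝔤] [LieAlgebra ℝ 𝔤] [TopologicalSpace 𝔤] {S : Stratification 𝔤}

/-- `Φ_{s,φ}(u) = ∬ φ(|u(x) - u(y)| / ‖y⁻¹ · x‖^s) dx dy / ‖y⁻¹ · x‖^Q`, for `0 < s < 1`, with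
values in `[0, ∞]`. -/
def fracModular (N : S.HomogeneousNorm) (μ : Measure 𝔤) (φ : ℝ → ℝ) (s : ℝ) (u : 𝔤 → ℝ) :
    ℝ≥0∞ :=
  ∫⁻ z : 𝔤 × 𝔤,
    ENNReal.ofReal (φ (|u z.1 - u z.2| / N.toFun (S.mul (-z.2) z.1) ^ s) /
      N.toFun (S.mul (-z.2) z.1) ^ S.homDim) ∂(μ.prod μ)

/-- The space `W^{s,φ}`, for `0 < s < 1`. -/
def fracSpace (N : S.HomogeneousNorm) (μ : Measure 𝔤) (φ : ℝ → ℝ) (s : ℝ) : Set (𝔤 → ℝ) :=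
  {u | AEMeasurable u μ ∧ orliczModular μ φ u < ∞ ∧ fracModular N μ φ s u < ∞}

/-- `C_b`, the measure of the unit ball. -/
def ballMeasure (N : S.HomogeneousNorm) (μ : Measure 𝔤) : ℝ≥0∞ := μ {x | N.toFun x < 1}

end Carnot

end

/-! As `s ↓ 0` only the large values of `‖w‖`, `w = y⁻¹·x`, survive the factor `s`. For a fixed
value `t`, polar coordinates turn the integral of the kernel over `‖w‖ ≥ ρ` into `Q C_b ∫_ρ^∞
φ(|t|/r^s) dr/r`. The substitution `τ = |t|/r^s` gives `φ(|t|/ρ^s) = s ∫_ρ^∞ τ a(τ) dr/r`, and `pm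
φ(τ) ≤ τ a(τ) ≤ pp φ(τ)` then places `s` times the tail between `(Q C_b/pp) φ(|t|/ρ^s)` and `(Q
C_b/pm) φ(|t|/ρ^s)`. Convexity and doubling give `φ(x + y) ≤ (C/2)(φ(x) + φ(y))`, which trades `u(x)
- u(y)` for the two separate values.

Upper bound (`mul_fracModular_le`): where `‖w‖ < 1` the kernel increases with the order, so one
finite modular of order `s₀` dominates and disappears after multiplication by `s`. Where `‖w‖ ≥ 1`,
the values `u(x)` and `u(y)` contribute equally, and `2 · C/2 = C`.

Lower bound (`le_mul_fracModular_add`): keep only the disjoint regions where one point is much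
farther from the origin than the other. In each, the near point gives the main term with constant
`2/C`, whence `4/C` in total; the far point's value costs at most `C_b Φ_φ(u)`, which again
disappears after multiplication by `s`. The tail starts at `ρ(x) = 2 + 3‖x‖`, and `ρ(x)^s → 1` is
handled by dominated convergence.

The group law enters through its continuity, the inequalities of the norm, and the invariance of
Haar measure under `x ↦ y⁻¹·x` and `y ↦ y⁻¹·x`. The latter follows from triangularity of the
Baker–Campbell–Hausdorff formula; associativity plays no role. -/

noncomputable section

namespace Carnot

/-! ### Linear and bracket parts of the Baker–Campbell–Hausdorff product. -/

section Words

/-- The word of `dynkinWord p x y` in the letters `true` (for `x`) and `false` (for `y`). -/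
def dynkinBoolWord {k : ℕ} (p : Fin k → ℕ × ℕ) : List Bool :=
  (List.ofFn fun i => List.replicate (p i).1 true ++ List.replicate (p i).2 false).flatten

theorem dynkinWord_eq_map {k : ℕ} {𝔤 : Type*} [LieRing 𝔤] (p : Fin k → ℕ × ℕ)
    (x y : 𝔤) :
    dynkinWord p x y = (dynkinBoolWord p).map fun b => cond b x y := by
  simp [dynkinWord, dynkinBoolWord, List.map_flatten, List.map_ofFn, Function.comp_def]

theorem length_dynkinBoolWord {k : ℕ} (p : Fin k → ℕ × ℕ) :
    (dynkinBoolWord p).length = ∑ i, ((p i).1 + (p i).2) := by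
  simp [dynkinBoolWord, List.length_flatten, List.map_ofFn, Function.comp_def, List.sum_ofFn]

/-- The coefficient of a word in Dynkin's formula. -/
def dynkinCoeff {k : ℕ} (p : Fin k → ℕ × ℕ) : ℝ :=
  (-1 : ℝ) ^ (k - 1) /
    ((k : ℝ) * ((∑ i, ((p i).1 + (p i).2) : ℕ) : ℝ) *
      ((∏ i, ((p i).1.factorial * (p i).2.factorial) : ℕ) : ℝ))

variable {𝔤 : Type*} [LieRing 𝔤] [LieAlgebra ℝ 𝔤]

/-- The part of the Baker-Campbell-Hausdorff product made of brackets of at least two letters. -/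
def bchRem (c : ℕ) (x y : 𝔤) : 𝔤 :=
  ∑ k ∈ Finset.Icc 1 c,
    ∑ p ∈ Fintype.piFinset (fun _ : Fin k =>
        (Finset.range (c + 1) ×ˢ Finset.range (c + 1)).erase (0, 0)),
      if 2 ≤ (dynkinBoolWord p).length then
        dynkinCoeff p • nestedBracket ((dynkinBoolWord p).map fun b => cond b x y) else 0

/-- A product of `k` nonempty blocks has at least `k` letters, so one-letter words occur only for `k
= 1`, as `(1, 0)` and `(0, 1)`, each with coefficient one. -/
theorem bch_eq_add_bchRem {c : ℕ} (hc : 1 ≤ c) (x y : 𝔤) :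
    bch c x y = x + y + bchRem c x y := by
  have key : bch c x y - bchRem c x y = x + y := by
    have h0 : bch c x y = ∑ k ∈ Finset.Icc 1 c,
        ∑ p ∈ Fintype.piFinset (fun _ : Fin k =>
          (Finset.range (c + 1) ×ˢ Finset.range (c + 1)).erase (0, 0)),
          dynkinCoeff p • nestedBracket ((dynkinBoolWord p).map fun b => cond b x y) := by
      simp only [bch, dynkinWord_eq_map, dynkinCoeff]
    rw [h0, bchRem, ← Finset.sum_sub_distrib]
    have hlen : ∀ k, ∀ p ∈ Fintype.piFinset (fun _ : Fin k =>
          (Finset.range (c + 1) ×ˢ Finset.range (c + 1)).erase (0, 0)),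
          ∀ i, 1 ≤ (p i).1 + (p i).2 := by
      intro k p hp i
      have h1 := (Finset.mem_erase.1 (Fintype.mem_piFinset.1 hp i)).1
      by_contra h2
      exact h1 (Prod.ext (by simp; omega) (by simp; omega))
    rw [Finset.sum_eq_single_of_mem 1 (Finset.mem_Icc.2 ⟨le_rfl, hc⟩)]
    · rw [← Finset.sum_sub_distrib]
      have hne : (fun _ : Fin 1 => ((1, 0) : ℕ × ℕ)) ≠ fun _ => (0, 1) := by
        intro h; have := congrFun h 0; simp at this
      rw [← Finset.sum_subset (s₁ := {fun _ => (1, 0), fun _ => (0, 1)}), Finset.sum_pair hne]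
      · simp [dynkinBoolWord, dynkinCoeff, nestedBracket]
      · intro p hp
        simp only [Finset.mem_insert, Finset.mem_singleton] at hp
        rw [Fintype.mem_piFinset]
        intro i
        rcases hp with rfl | rfl <;> simp <;> omega
      · intro p hp hp'
        have h1 := hlen 1 p hp 0
        rw [if_pos, sub_self]
        rw [length_dynkinBoolWord, Fin.sum_univ_one]
        by_contra h2
        apply hp'
        simp only [Finset.mem_insert, Finset.mem_singleton]
        rcases Nat.eq_zero_or_pos (p 0).1 with h3 | h3
        · right; funext i; rw [Subsingleton.elim i 0]; exact Prod.ext (by simp; omega) (by simp; omega)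
        · left; funext i; rw [Subsingleton.elim i 0]; exact Prod.ext (by simp; omega) (by simp; omega)
    · intro k hk hk1
      rw [← Finset.sum_sub_distrib]
      refine Finset.sum_eq_zero fun p hp => ?_
      rw [if_pos, sub_self]
      rw [length_dynkinBoolWord]
      have h2 : 2 ≤ k := by have := (Finset.mem_Icc.1 hk).1; omega
      calc 2 ≤ ∑ _i : Fin k, 1 := by simpa
        _ ≤ _ := Finset.sum_le_sum fun i _ => hlen k p hp i
  rw [← key]; abel

theorem continuous_nestedBracket [FiniteDimensional ℝ 𝔤]
    [TopologicalSpace 𝔤] [IsTopologicalAddGroup 𝔤] [ContinuousSMul ℝ 𝔤] [T2Space 𝔤] (w : List Bool) :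
    Continuous fun z : 𝔤 × 𝔤 => nestedBracket (w.map fun b => cond b z.1 z.2) := by
  have hbr : Continuous fun z : 𝔤 × 𝔤 => ⁅z.1, z.2⁆ := by
    let e := (Module.finBasis ℝ 𝔤)
    have : (fun z : 𝔤 × 𝔤 => ⁅z.1, z.2⁆) = fun z => ∑ i, e.repr z.1 i • ⁅e i, z.2⁆ := by
      funext z
      conv_lhs => rw [← e.sum_repr z.1]
      rw [sum_lie]; simp
    rw [this]
    refine continuous_finsetSum _ fun i _ => Continuous.smul ?_ ?_
    · exact ((e.coord i).continuous_of_finiteDimensional).comp continuous_fst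
    · exact ((LieModule.toEnd ℝ 𝔤 𝔤 (e i)).continuous_of_finiteDimensional).comp continuous_snd
  have hl : ∀ b : Bool, Continuous fun z : 𝔤 × 𝔤 => cond b z.1 z.2 := by
    rintro (_ | _)
    · exact continuous_snd
    · exact continuous_fst
  induction w with
  | nil => exact continuous_const
  | cons b w ih =>
    cases w with
    | nil => exact hl b
    | cons b' w => exact hbr.comp ((hl b).prodMk ih)

theorem continuous_bchRem [FiniteDimensional ℝ 𝔤]
    [TopologicalSpace 𝔤] [IsTopologicalAddGroup 𝔤] [ContinuousSMul ℝ 𝔤] [T2Space 𝔤] (c : ℕ) :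
    Continuous fun z : 𝔤 × 𝔤 => bchRem c z.1 z.2 := by
  refine continuous_finsetSum _ fun k _ => continuous_finsetSum _ fun p _ => ?_
  split_ifs
  · exact (continuous_nestedBracket _).const_smul _
  · exact continuous_const

end Words

/-! ### Layer projections and the filtration by weight. -/

namespace Stratification

variable {𝔤 : Type*} [LieRing 𝔤] [LieAlgebra ℝ 𝔤] (S : Stratification 𝔤)

/-- The projection onto a layer, as a linear map. -/
def proj (i : ℕ) : 𝔤 →ₗ[ℝ] 𝔤 :=
  (S.layer i).subtype ∘ₗ DirectSum.component ℝ ℕ (fun i => S.layer i) i ∘ₗ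
    (LinearEquiv.ofBijective (DirectSum.coeLinearMap S.layer) S.isInternal).symm.toLinearMap

theorem proj_apply (i : ℕ) (x : 𝔤) : S.proj i x = S.component i x := rfl

theorem proj_mem (i : ℕ) (x : 𝔤) : S.proj i x ∈ S.layer i := Subtype.coe_prop _

theorem proj_of_mem {i : ℕ} {x : 𝔤} (hx : x ∈ S.layer i) (j : ℕ) :
    S.proj j x = if i = j then x else 0 := by
  have h : (LinearEquiv.ofBijective (DirectSum.coeLinearMap S.layer) S.isInternal).symm x =
      DirectSum.lof ℝ ℕ (fun i => S.layer i) i ⟨x, hx⟩ := by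
    rw [LinearEquiv.symm_apply_eq]
    exact (DirectSum.coeLinearMap_lof S.layer i ⟨x, hx⟩).symm
  rw [proj_apply, component, h]
  split_ifs with hij
  · subst hij; simp
  · rw [DirectSum.lof_eq_of, DirectSum.of_eq_of_ne _ _ _ (Ne.symm hij)]; rfl

theorem layer_eq_bot_of_notMem {i : ℕ} (hi : i ∉ Finset.Icc 1 S.step) : S.layer i = ⊥ := by
  rcases Nat.eq_zero_or_pos i with rfl | h
  · exact S.layer_zero
  · exact S.layer_eq_bot i (by rw [Finset.mem_Icc] at hi; omega)

theorem proj_eq_zero {i : ℕ} (hi : i ∉ Finset.Icc 1 S.step) (x : 𝔤) : S.proj i x = 0 := by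
  have := S.proj_mem i x
  rwa [S.layer_eq_bot_of_notMem hi, Submodule.mem_bot] at this

theorem sum_proj (x : 𝔤) : ∑ i ∈ Finset.Icc 1 S.step, S.proj i x = x := by
  classical
  set e := LinearEquiv.ofBijective (DirectSum.coeLinearMap S.layer) S.isInternal
  obtain ⟨d, rfl⟩ := e.surjective x
  induction d using DirectSum.induction_on with
  | zero => simp
  | of i v =>
    have : e (DirectSum.of (fun i => S.layer i) i v) = v :=
      DirectSum.coeLinearMap_of S.layer i v
    rw [this]
    simp only [S.proj_of_mem v.2]
    rw [Finset.sum_ite_eq]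
    split_ifs with h
    · rfl
    · exact ((Submodule.mem_bot ℝ).1 ((S.layer_eq_bot_of_notMem h).le v.2)).symm
  | add a b ha hb => simp only [map_add, Finset.sum_add_distrib, ha, hb]

/-- The stratification only prescribes brackets with `V₁`. Since `V₁` generates, induction on `i`
and the Jacobi identity give the full grading. -/
theorem lie_mem_layer {i j : ℕ} {x y : 𝔤} (hx : x ∈ S.layer i) (hy : y ∈ S.layer j) :
    ⁅x, y⁆ ∈ S.layer (i + j) := by
  have h1 : ∀ j (x y : 𝔤), x ∈ S.layer 1 → y ∈ S.layer j → ⁅x, y⁆ ∈ S.layer (j + 1) := by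
    intro j x y hx hy
    rcases Nat.eq_zero_or_pos j with rfl | hj
    · rw [S.layer_zero, Submodule.mem_bot] at hy
      simp [hy]
    · rw [← S.span_bracket j hj]
      exact Submodule.subset_span ⟨x, hx, y, hy, rfl⟩
  induction i generalizing x y j with
  | zero =>
    rw [S.layer_zero, Submodule.mem_bot] at hx
    simp [hx]
  | succ i ih =>
    rcases Nat.eq_zero_or_pos i with rfl | hi
    · rw [add_comm]; exact h1 j x y hx hy
    · rw [← S.span_bracket i hi] at hx
      induction hx using Submodule.span_induction with
      | zero => simp
      | add a b _ _ ha hb => rw [add_lie]; exact Submodule.add_mem _ ha hb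
      | smul r a _ ha => rw [smul_lie]; exact Submodule.smul_mem _ _ ha
      | mem z hz =>
        obtain ⟨a, ha, b, hb, rfl⟩ := hz
        rw [lie_lie]
        refine Submodule.sub_mem _ ?_ ?_
        · have := h1 _ a _ ha (ih hb hy)
          rwa [show i + j + 1 = i + 1 + j by omega] at this
        · have := ih hb (h1 _ a y ha hy)
          rwa [show i + (j + 1) = i + 1 + j by omega] at this

/-- The vectors whose components in the layers below the `i`-th vanish. -/
def filtration (i : ℕ) : Submodule ℝ 𝔤 := ⨅ j : Set.Iio i, LinearMap.ker (S.proj j)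

theorem mem_filtration {i : ℕ} {x : 𝔤} : x ∈ S.filtration i ↔ ∀ j < i, S.proj j x = 0 := by
  simp [filtration]

theorem filtration_antitone : Antitone S.filtration := fun _ _ hij _ hx =>
  S.mem_filtration.2 fun k hk => S.mem_filtration.1 hx k (hk.trans_le hij)

theorem mem_filtration_one (x : 𝔤) : x ∈ S.filtration 1 := by
  rw [mem_filtration]
  intro j hj
  exact S.proj_eq_zero (by simp; omega) x

theorem layer_le_filtration {i j : ℕ} (hij : j ≤ i) : S.layer i ≤ S.filtration j := fun x hx =>
  S.mem_filtration.2 fun k hk => by rw [S.proj_of_mem hx, if_neg (by omega)]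

theorem lie_mem_filtration {i j : ℕ} {x y : 𝔤} (hx : x ∈ S.filtration i)
    (hy : y ∈ S.filtration j) : ⁅x, y⁆ ∈ S.filtration (i + j) := by
  rw [mem_filtration] at hx hy
  rw [← S.sum_proj x, ← S.sum_proj y, sum_lie]
  refine Submodule.sum_mem _ fun k _ => ?_
  rw [lie_sum]
  refine Submodule.sum_mem _ fun l _ => ?_
  rcases lt_or_ge k i with hk | hk
  · simp [hx k hk]
  rcases lt_or_ge l j with hl | hl
  · simp [hy l hl]
  exact S.layer_le_filtration (by omega) (S.lie_mem_layer (S.proj_mem k x) (S.proj_mem l y))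

/-- Telescoping: each term has one slot holding a difference in filtration `i`, and every further
slot has weight at least one. A genuine bracket thus gains a degree; a single letter does not, so
the induction carries both claims. -/
theorem nestedBracket_sub_mem_filtration {i : ℕ} {x x' y y' : 𝔤}
    (hx : x - x' ∈ S.filtration i) (hy : y - y' ∈ S.filtration i) (w : List Bool) :
    nestedBracket (w.map fun b => cond b x y) - nestedBracket (w.map fun b => cond b x' y') ∈
        S.filtration i ∧
      (2 ≤ w.length →
        nestedBracket (w.map fun b => cond b x y) - nestedBracket (w.map fun b => cond b x' y') ∈
          S.filtration (i + 1)) := by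
  have hl : ∀ b : Bool, cond b x y - cond b x' y' ∈ S.filtration i := by
    rintro (_ | _)
    · exact hy
    · exact hx
  induction w with
  | nil => simp [nestedBracket]
  | cons b w ih =>
    cases w with
    | nil => simpa [nestedBracket] using hl b
    | cons b' w =>
      have key : nestedBracket ((b :: b' :: w).map fun b => cond b x y) -
          nestedBracket ((b :: b' :: w).map fun b => cond b x' y') ∈ S.filtration (i + 1) := by
        set B := nestedBracket ((b' :: w).map fun b => cond b x y)
        set B' := nestedBracket ((b' :: w).map fun b => cond b x' y')
        have : nestedBracket ((b :: b' :: w).map fun b => cond b x y) -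
            nestedBracket ((b :: b' :: w).map fun b => cond b x' y') =
            ⁅cond b x y - cond b x' y', B⁆ + ⁅cond b x' y', B - B'⁆ := by
          rw [sub_lie, lie_sub]
          change ⁅cond b x y, B⁆ - ⁅cond b x' y', B'⁆ = _
          abel
        rw [this]
        refine Submodule.add_mem _ (S.lie_mem_filtration (hl b) (S.mem_filtration_one _)) ?_
        rw [add_comm]
        exact S.lie_mem_filtration (S.mem_filtration_one _) ih.1
      exact ⟨S.filtration_antitone (Nat.le_succ i) key, fun _ => key⟩

theorem bchRem_sub_mem_filtration (c : ℕ) {i : ℕ} {x x' y y' : 𝔤}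
    (hx : x - x' ∈ S.filtration i) (hy : y - y' ∈ S.filtration i) :
    bchRem c x y - bchRem c x' y' ∈ S.filtration (i + 1) := by
  simp only [bchRem, ← Finset.sum_sub_distrib]
  refine Submodule.sum_mem _ fun k _ => Submodule.sum_mem _ fun p _ => ?_
  split_ifs with h
  · rw [← smul_sub]
    exact Submodule.smul_mem _ _ ((S.nestedBracket_sub_mem_filtration hx hy _).2 h)
  · simp

end Stratification

end Carnot

/-! ### Shears and Haar measure. -/

section FiniteDimensional

variable {E : Type*} [AddCommGroup E] [Module ℝ E] [FiniteDimensional ℝ E]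
    [TopologicalSpace E] [IsTopologicalAddGroup E] [ContinuousSMul ℝ E] [T2Space E]

variable (E) in
theorem secondCountableTopology_of_finiteDimensional : SecondCountableTopology E :=
  (Module.finBasis ℝ E).equivFunL.toHomeomorph.secondCountableTopology

variable (E) in
theorem locallyCompactSpace_of_finiteDimensional : LocallyCompactSpace E :=
  (Module.finBasis ℝ E).equivFunL.toHomeomorph.isClosedEmbedding.locallyCompactSpace

/-- Adding to `x` a vector `g x` of a subspace `V` that depends only on the class of `x` modulo `V`
preserves the Haar measure. -/
theorem measurePreserving_add_of_invariant [MeasurableSpace E] [BorelSpace E]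
    (μ : Measure E) [μ.IsAddHaarMeasure] (V : Submodule ℝ E) {g : E → E} (hg : Continuous g)
    (hgV : ∀ x, g x ∈ V) (hinv : ∀ x, ∀ v ∈ V, g (x + v) = g x) :
    MeasurePreserving (fun x => x + g x) μ μ := by
  have := secondCountableTopology_of_finiteDimensional E
  have := locallyCompactSpace_of_finiteDimensional E
  obtain ⟨W, hW⟩ := V.exists_isCompl
  have := secondCountableTopology_of_finiteDimensional V
  have := locallyCompactSpace_of_finiteDimensional V
  have := secondCountableTopology_of_finiteDimensional W
  have := locallyCompactSpace_of_finiteDimensional W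
  -- In coordinates `W × V` the map fixes `w` and translates the fibre `V` by a vector depending on
  -- `w` alone. Fubini applies, and by uniqueness `μ` is a multiple of the product Haar measure.
  let e : (W × V) ≃L[ℝ] E := (Submodule.prodEquivOfIsCompl W V hW.symm).toContinuousLinearEquiv
  have he : ∀ p : W × V, e p = p.1 + p.2 := fun p =>
    Submodule.coe_prodEquivOfIsCompl' W V hW.symm p
  let μW : Measure W := Measure.addHaar
  let μV : Measure V := Measure.addHaar
  let ν : Measure (W × V) := μW.prod μV
  have : (ν.map e).IsAddHaarMeasure := e.isAddHaarMeasure_map ν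
  have hμ : μ = Measure.addHaarScalarFactor μ (ν.map e) • ν.map e :=
    Measure.isAddLeftInvariant_eq_smul μ (ν.map e)
  have : SFinite μV := inferInstance
  let sh : W × V → W × V := fun p => (p.1, p.2 + ⟨g p.1, hgV _⟩)
  have hsh : MeasurePreserving sh ν ν := by
    have hm : Measurable (Function.uncurry fun (w : W) (v : V) => v + ⟨g w, hgV w⟩) := by
      have : Continuous fun p : W × V => p.2 + (⟨g p.1, hgV _⟩ : V) :=
        continuous_snd.add ((hg.comp (continuous_subtype_val.comp continuous_fst)).subtype_mk _)
      exact this.measurable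
    exact MeasurePreserving.skew_product (g := fun (w : W) (v : V) => v + ⟨g w, hgV w⟩)
      (MeasurePreserving.id μW) hm (Eventually.of_forall fun w => map_add_right_eq_self μV _)
  have hmeas : Measurable fun x => x + g x := (continuous_id.add hg).measurable
  refine ⟨hmeas, ?_⟩
  have hem : Measurable e := e.continuous.measurable
  have hcomp : (fun x => x + g x) ∘ e = e ∘ sh := by
    funext p
    have h1 : g (e p) = g p.1 := by rw [he]; exact hinv _ _ p.2.2
    simp only [Function.comp_apply, h1]
    rw [he, he]
    simp only [sh, Submodule.coe_add]
    abel
  have : (ν.map e).map (fun x => x + g x) = ν.map e := by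
    rw [Measure.map_map hmeas hem, hcomp, ← Measure.map_map hem hsh.measurable, hsh.map_eq]
  rw [hμ, Measure.map_smul, this]

end FiniteDimensional

namespace Carnot

/-! ### Invariance of Haar measure under the group translations. -/

namespace Stratification

variable {𝔤 : Type*} [LieRing 𝔤] [LieAlgebra ℝ 𝔤] [FiniteDimensional ℝ 𝔤]
    [TopologicalSpace 𝔤] [IsTopologicalAddGroup 𝔤] [ContinuousSMul ℝ 𝔤] [T2Space 𝔤]
    [MeasurableSpace 𝔤] [BorelSpace 𝔤] (S : Stratification 𝔤)
    (μ : Measure 𝔤) [μ.IsAddHaarMeasure]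

omit [MeasurableSpace 𝔤] [BorelSpace 𝔤] in
theorem continuous_proj (i : ℕ) : Continuous (S.proj i) :=
  (S.proj i).continuous_of_finiteDimensional

/-- Perturbations of the identity that are strictly triangular for the stratification preserve the
Haar measure. -/
theorem measurePreserving_add_of_triangular {f : 𝔤 → 𝔤} (hf : Continuous f)
    (htri : ∀ i x x', x - x' ∈ S.filtration i → f x - f x' ∈ S.filtration (i + 1)) :
    MeasurePreserving (fun x => x + f x) μ μ := by
  have hproj : ∀ i x x', x - x' ∈ S.filtration i → S.proj i (f x) = S.proj i (f x') := by
    intro i x x' h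
    have := S.mem_filtration.1 (htri i x x' h) i (Nat.lt_succ_self i)
    rwa [map_sub, sub_eq_zero] at this
  -- The map is built from the top layer downwards, one shear at a time; `n` counts the layers
  -- already treated.
  have main : ∀ n, n ≤ S.step → MeasurePreserving
      (fun x => x + ∑ i ∈ Finset.Icc (S.step - n + 1) S.step, S.proj i (f x)) μ μ := by
    intro n
    induction n with
    | zero => intro _; simp only [Nat.sub_zero, Finset.Icc_eq_empty_of_lt (Nat.lt_succ_self S.step),
        Finset.sum_empty, add_zero]; exact MeasurePreserving.id μ
    | succ n ih =>
      intro hn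
      set m := S.step - n with hm
      have hm' : S.step - (n + 1) + 1 = m := by omega
      rw [hm']
      have hshear : MeasurePreserving (fun x => x + S.proj m (f x)) μ μ := by
        refine measurePreserving_add_of_invariant μ (S.layer m) ((S.continuous_proj m).comp hf)
          (fun x => S.proj_mem m _) fun x v hv => hproj m _ _ ?_
        rw [add_sub_cancel_left]
        exact S.layer_le_filtration le_rfl hv
      have hcomp := hshear.comp (ih (by omega))
      convert hcomp using 1
      funext x
      -- The earlier shears moved `x` only in layers above `m`, which the `m`-th component of `f`
      -- does not see. The composition therefore adds exactly the components of `f x`.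
      have h1 : S.proj m (f (x + ∑ i ∈ Finset.Icc (m + 1) S.step, S.proj i (f x))) =
          S.proj m (f x) := by
        refine hproj m _ _ ?_
        rw [add_sub_cancel_left]
        refine Submodule.sum_mem _ fun i hi => ?_
        exact S.layer_le_filtration (by have := (Finset.mem_Icc.1 hi).1; omega) (S.proj_mem i _)
      simp only [Function.comp_apply, h1]
      rw [← Finset.insert_Icc_succ_left_eq_Icc (show m ≤ S.step by omega),
        Finset.sum_insert (by simp)]
      simp only [Nat.succ_eq_succ, Nat.succ_eq_add_one]
      abel
  have h := main S.step le_rfl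
  simpa only [Nat.sub_self, zero_add, S.sum_proj] using h

omit [MeasurableSpace 𝔤] [BorelSpace 𝔤] in
theorem continuous_mul : Continuous fun z : 𝔤 × 𝔤 => S.mul z.1 z.2 := by
  simp only [mul, bch_eq_add_bchRem S.one_le_step]
  exact (continuous_fst.add continuous_snd).add (continuous_bchRem _)

theorem measurePreserving_mul_left (y : 𝔤) : MeasurePreserving (fun x => S.mul y x) μ μ := by
  have hy : Continuous fun x : 𝔤 => (y, x) := by fun_prop
  have hc := (continuous_bchRem S.step).comp hy
  have h := S.measurePreserving_add_of_triangular μ (f := fun x => bchRem S.step y x) hc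
    fun i x x' h => S.bchRem_sub_mem_filtration _ (by simp) h
  have h2 : (fun x => S.mul y x) = (fun x => y + x) ∘ fun x => x + bchRem S.step y x := by
    funext x
    simp only [mul, bch_eq_add_bchRem S.one_le_step, Function.comp_apply, add_assoc]
  rw [h2]
  exact (measurePreserving_add_left μ y).comp h

theorem measurePreserving_mul_right (y : 𝔤) : MeasurePreserving (fun x => S.mul x y) μ μ := by
  have hy : Continuous fun x : 𝔤 => (x, y) := by fun_prop
  have hc := (continuous_bchRem S.step).comp hy
  have h := S.measurePreserving_add_of_triangular μ (f := fun x => bchRem S.step x y) hc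
    fun i x x' h => S.bchRem_sub_mem_filtration _ h (by simp)
  have h2 : (fun x => S.mul x y) = (fun x => y + x) ∘ fun x => x + bchRem S.step x y := by
    funext x
    simp only [mul, bch_eq_add_bchRem S.one_le_step, Function.comp_apply]
    abel
  rw [h2]
  exact (measurePreserving_add_left μ y).comp h

/-- Inversion is `y ↦ -y` in exponential coordinates, so this is a reflection followed by a right
translation. -/
theorem measurePreserving_neg_mul (x : 𝔤) : MeasurePreserving (fun y => S.mul (-y) x) μ μ := by
  have := secondCountableTopology_of_finiteDimensional 𝔤
  have := locallyCompactSpace_of_finiteDimensional 𝔤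
  have : μ.IsNegInvariant := Measure.IsAddHaarMeasure.isNegInvariant_of_regular μ
  exact (S.measurePreserving_mul_right μ x).comp (Measure.measurePreserving_neg μ)

end Stratification

end Carnot

/-! ### Dilations and their Jacobian. -/

namespace Carnot

namespace Stratification

variable {𝔤 : Type*} [LieRing 𝔤] [LieAlgebra ℝ 𝔤] (S : Stratification 𝔤)

theorem dilation_one (x : 𝔤) : S.dilation 1 x = x := by
  simpa [dilation, proj_apply] using S.sum_proj x

theorem dilation_zero (x : 𝔤) : S.dilation 0 x = 0 := by
  refine Finset.sum_eq_zero fun i hi => ?_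
  rw [zero_pow (by have := (Finset.mem_Icc.1 hi).1; omega), zero_smul]

theorem dilation_of_mem (r : ℝ) {i : ℕ} {x : 𝔤} (hx : x ∈ S.layer i) :
    S.dilation r x = r ^ i • x := by
  have h : ∀ j, S.component j x = if i = j then x else 0 := S.proj_of_mem hx
  simp only [dilation, h, smul_ite, smul_zero, Finset.sum_ite_eq]
  split_ifs with hi
  · rfl
  · rw [(Submodule.mem_bot ℝ).1 ((S.layer_eq_bot_of_notMem hi).le hx), smul_zero]

/-- A basis of the Lie algebra adapted to the stratification. -/
def adaptedBasis [FiniteDimensional ℝ 𝔤] :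
    Module.Basis (Σ i, Fin (Module.finrank ℝ (S.layer i))) ℝ 𝔤 :=
  S.isInternal.collectedBasis fun i => Module.finBasis ℝ (S.layer i)

theorem sum_adaptedBasis_index [FiniteDimensional ℝ 𝔤]
    [Fintype (Σ i, Fin (Module.finrank ℝ (S.layer i)))] :
    ∑ j : (Σ i, Fin (Module.finrank ℝ (S.layer i))), j.1 = S.homDim := by
  have h : (Finset.univ : Finset (Σ i, Fin (Module.finrank ℝ (S.layer i)))) =
      (Finset.Icc 1 S.step).sigma fun _ => Finset.univ := by
    ext j
    simp only [Finset.mem_univ, Finset.mem_sigma, and_true, true_iff]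
    by_contra hj
    have h0 := S.layer_eq_bot_of_notMem hj
    have h1 : Module.finrank ℝ (S.layer j.1) = 0 := by rw [h0]; exact finrank_bot ℝ 𝔤
    have := j.2.2
    omega
  rw [h, Finset.sum_sigma, homDim]
  simp [mul_comm]

variable [TopologicalSpace 𝔤] [IsTopologicalAddGroup 𝔤] [ContinuousSMul ℝ 𝔤]

theorem continuous_dilation_left (x : 𝔤) : Continuous fun r => S.dilation r x :=
  continuous_finsetSum _ fun i _ => (continuous_pow i).smul continuous_const

variable [FiniteDimensional ℝ 𝔤] [T2Space 𝔤] [MeasurableSpace 𝔤] [BorelSpace 𝔤]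

/-- In an adapted basis the dilation is diagonal, with entry `r ^ i` repeated `dim Vᵢ` times, so its
determinant is `r ^ Q`. -/
theorem addHaar_preimage_dilation (μ : Measure 𝔤) [μ.IsAddHaarMeasure] {r : ℝ} (hr : 0 < r)
    {s : Set 𝔤} (hs : MeasurableSet s) :
    μ (S.dilation r ⁻¹' s) = ENNReal.ofReal ((r ^ S.homDim)⁻¹) * μ s := by
  classical
  let b := S.adaptedBasis
  let : Fintype (Σ i, Fin (Module.finrank ℝ (S.layer i))) := FiniteDimensional.fintypeBasisIndex b
  let e := b.equivFunL
  let d : (Σ i, Fin (Module.finrank ℝ (S.layer i))) → ℝ := fun j => r ^ j.1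
  let D := Matrix.toLin' (Matrix.diagonal d)
  have hdet : LinearMap.det D = r ^ S.homDim := by
    rw [LinearMap.det_toLin', Matrix.det_diagonal, Finset.prod_pow_eq_pow_sum,
      S.sum_adaptedBasis_index]
  have hdet0 : LinearMap.det D ≠ 0 := by rw [hdet]; positivity
  have hcomm : ∀ x, e (S.dilation r x) = D (e x) := by
    let δ : 𝔤 →ₗ[ℝ] 𝔤 := ∑ i ∈ Finset.Icc 1 S.step, r ^ i • S.proj i
    have hδ : ∀ x, S.dilation r x = δ x := fun x => by
      simp [δ, dilation, proj_apply]
    have : e.toLinearEquiv.toLinearMap ∘ₗ δ = D ∘ₗ e.toLinearEquiv.toLinearMap := by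
      refine b.ext fun j => ?_
      have hb : b j ∈ S.layer j.1 := S.isInternal.collectedBasis_mem _ j
      have he : e (b j) = Pi.single j 1 := by
        funext k; simp [e, Finsupp.single_apply, Pi.single_apply, eq_comm]
      change e (δ (b j)) = D (e (b j))
      rw [← hδ, S.dilation_of_mem r hb, map_smul, he]
      simp only [D, Matrix.toLin'_apply]
      funext k
      rw [Matrix.mulVec_diagonal]
      rcases eq_or_ne k j with rfl | hkj
      · simp [d]
      · simp [hkj]
    intro x
    rw [hδ]
    exact LinearMap.congr_fun this x
  have hem : Measurable e := e.continuous.measurable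
  have : (μ.map e).IsAddHaarMeasure := e.isAddHaarMeasure_map μ
  have h1 : S.dilation r ⁻¹' s = e ⁻¹' (D ⁻¹' (e.symm ⁻¹' s)) := by
    ext x
    simp [← hcomm]
  have hs' : MeasurableSet (e.symm ⁻¹' s) := e.symm.continuous.measurable hs
  have hD : Measurable D := (LinearMap.continuous_of_finiteDimensional D).measurable
  rw [h1, ← Measure.map_apply hem (hD hs'), Measure.addHaar_preimage_linearMap _ hdet0,
    Measure.map_apply hem hs', hdet, abs_of_pos (by positivity)]
  congr 2
  ext x
  simp

end Stratification

/-! ### Balls of the homogeneous norm and polar coordinates. -/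

namespace Stratification.HomogeneousNorm

variable {𝔤 : Type*} [LieRing 𝔤] [LieAlgebra ℝ 𝔤] {S : Stratification 𝔤} [FiniteDimensional ℝ 𝔤]
    [TopologicalSpace 𝔤] [IsTopologicalAddGroup 𝔤] [ContinuousSMul ℝ 𝔤] [T2Space 𝔤]
    [MeasurableSpace 𝔤] [BorelSpace 𝔤] (N : S.HomogeneousNorm)
    (μ : Measure 𝔤) [μ.IsAddHaarMeasure]

omit [FiniteDimensional ℝ 𝔤] [IsTopologicalAddGroup 𝔤] [ContinuousSMul ℝ 𝔤] [T2Space 𝔤] in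
theorem measurableSet_lt (r : ℝ) : MeasurableSet {x | N.toFun x < r} :=
  _root_.measurableSet_lt N.continuous'.measurable measurable_const

theorem measure_lt {r : ℝ} (hr : 0 < r) :
    μ {x | N.toFun x < r} = ENNReal.ofReal (r ^ S.homDim) * ballMeasure N μ := by
  have h : {x | N.toFun x < r} = S.dilation r⁻¹ ⁻¹' {x | N.toFun x < 1} := by
    ext x
    simp only [Set.mem_ofPred_eq, Set.mem_preimage]
    rw [N.dilation' _ (inv_pos.2 hr), inv_mul_lt_iff₀ hr, mul_one]
  rw [h, S.addHaar_preimage_dilation μ (inv_pos.2 hr) (N.measurableSet_lt 1), ballMeasure, inv_pow, inv_inv]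

-- The norm has a positive lower bound `m` on the boundary of a compact neighbourhood `K` of `0`.
-- The dilation path from `0` to a point outside `K` crosses that boundary, and the norm only grows
-- along it. Finiteness of `C_b` follows.
omit [MeasurableSpace 𝔤] [BorelSpace 𝔤] in
theorem exists_lt_subset_isCompact : ∃ m > 0, ∃ K, IsCompact K ∧ {x | N.toFun x < m} ⊆ K := by
  have := locallyCompactSpace_of_finiteDimensional 𝔤
  obtain ⟨K, hK, h0⟩ := exists_compact_mem_nhds (0 : 𝔤)
  have hfr : IsCompact (frontier K) := hK.of_isClosed_subset isClosed_frontier hK.isClosed.frontier_subset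
  have hpos : ∀ x ∈ frontier K, 0 < N.toFun x := by
    intro x hx
    refine (N.nonneg' x).lt_of_ne' fun h => ?_
    rw [N.eq_zero_iff'] at h
    subst h
    exact hx.2 (mem_interior_iff_mem_nhds.2 h0)
  obtain ⟨m, hm, hmin⟩ := hfr.exists_forall_le' N.continuous'.continuousOn hpos
  refine ⟨m, hm, K, hK, fun x hx => ?_⟩
  by_contra hxK
  have hconn : IsPreconnected ((fun r => S.dilation r x) '' Set.Icc 0 1) :=
    isPreconnected_Icc.image _ (S.continuous_dilation_left x).continuousOn
  obtain ⟨y, ⟨r, hr, rfl⟩, hy⟩ :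
      (((fun r => S.dilation r x) '' Set.Icc 0 1) ∩ frontier K).Nonempty := by
    by_contra hne
    obtain ⟨z, -, hz, hz'⟩ := hconn (interior K) Kᶜ isOpen_interior hK.isClosed.isOpen_compl
      (fun z hz => by
        by_contra hz'
        simp only [Set.mem_union, Set.mem_compl_iff, not_or, not_not] at hz'
        exact hne ⟨z, hz, subset_closure hz'.2, hz'.1⟩)
      ⟨0, ⟨0, by simp, S.dilation_zero x⟩, mem_interior_iff_mem_nhds.2 h0⟩
      ⟨x, ⟨1, by simp, S.dilation_one x⟩, hxK⟩
    exact hz' (interior_subset hz)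
  have h1 := hmin _ hy
  rcases hr.1.eq_or_lt with rfl | hr0
  · simp only [S.dilation_zero, (N.eq_zero_iff' 0).2 rfl] at h1
    linarith
  · simp only [N.dilation' r hr0] at h1
    have : r * N.toFun x ≤ N.toFun x := mul_le_of_le_one_left (N.nonneg' x) hr.2
    have hx' : N.toFun x < m := hx
    linarith

theorem ballMeasure_lt_top : ballMeasure N μ < ∞ := by
  obtain ⟨m, hm, K, hK, hsub⟩ := N.exists_lt_subset_isCompact
  have h := (measure_mono hsub).trans_lt (hK.measure_lt_top (μ := μ))
  rw [N.measure_lt μ hm] at h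
  refine ENNReal.lt_top_of_mul_ne_top_right h.ne ?_
  simpa using pow_pos hm _

theorem measure_lt_lt_top (r : ℝ) : μ {x | N.toFun x < r} < ∞ := by
  have h1 : {x | N.toFun x < r} ⊆ {x | N.toFun x < max r 1} := fun x (hx : N.toFun x < r) =>
    (lt_max_of_lt_left hx : N.toFun x < max r 1)
  refine (measure_mono h1).trans_lt ?_
  rw [N.measure_lt μ (lt_max_of_lt_right one_pos)]
  exact ENNReal.mul_lt_top ENNReal.ofReal_lt_top (N.ballMeasure_lt_top μ)

theorem measure_Ico {a b : ℝ} (ha : 0 < a) (hab : a ≤ b) :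
    μ (N.toFun ⁻¹' Set.Ico a b) =
      ENNReal.ofReal (b ^ S.homDim - a ^ S.homDim) * ballMeasure N μ := by
  have h : N.toFun ⁻¹' Set.Ico a b = {x | N.toFun x < b} \ {x | N.toFun x < a} := by
    ext x; simp [and_comm]
  rw [h, measure_sdiff (s₁ := {x | N.toFun x < b}) (s₂ := {x | N.toFun x < a})
    (fun x (hx : N.toFun x < a) => (hx.trans_le hab : N.toFun x < b))
    (N.measurableSet_lt a).nullMeasurableSet (N.measure_lt_lt_top μ a).ne,
    N.measure_lt μ (ha.trans_le hab), N.measure_lt μ ha, ENNReal.ofReal_sub _ (by positivity),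
    ENNReal.sub_mul fun _ _ => (N.ballMeasure_lt_top μ).ne]

/-- Integration in polar coordinates of a function of the homogeneous norm. -/
theorem setLIntegral_comp {ρ : ℝ} (hρ : 0 < ρ) {f : ℝ → ℝ≥0∞} (hf : Measurable f) :
    ∫⁻ x in {x | ρ ≤ N.toFun x}, f (N.toFun x) ∂μ =
      ballMeasure N μ * ∫⁻ r in Set.Ici ρ, ENNReal.ofReal (S.homDim * r ^ (S.homDim - 1)) * f r := by
  have hN : Measurable N.toFun := N.continuous'.measurable
  let w : ℝ → ℝ≥0∞ := fun r => ENNReal.ofReal (S.homDim * r ^ (S.homDim - 1))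
  have hw : Measurable w := by fun_prop
  -- The law of the norm has density `Q C_b r^(Q-1)` on `[ρ, ∞)`: both measures agree on half-open
  -- intervals because the ball of radius `r` has measure `C_b r^Q`.
  have hmeas : (μ.map N.toFun).restrict (Set.Ici ρ) =
      ballMeasure N μ • (volume.restrict (Set.Ici ρ)).withDensity w := by
    have : IsLocallyFiniteMeasure ((μ.map N.toFun).restrict (Set.Ici ρ)) := by
      refine ⟨fun x => ⟨Set.Iio (x + 1), Iio_mem_nhds (by linarith), ?_⟩⟩
      refine (Measure.restrict_apply_le _ _).trans_lt ?_
      rw [Measure.map_apply hN measurableSet_Iio]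
      exact N.measure_lt_lt_top μ _
    refine Measure.ext_of_Ico _ _ fun a b hab => ?_
    have hI : Set.Ico a b ∩ Set.Ici ρ = Set.Ico (max a ρ) b := by
      ext x; simp [and_assoc, and_comm]
    rw [Measure.restrict_apply measurableSet_Ico, hI, Measure.map_apply hN measurableSet_Ico,
      Measure.smul_apply, withDensity_apply _ measurableSet_Ico,
      Measure.restrict_restrict measurableSet_Ico, hI, smul_eq_mul]
    rcases le_total b (max a ρ) with h | h
    · simp [Set.Ico_eq_empty_of_le h]
    have hc : 0 < max a ρ := lt_max_of_lt_right hρ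
    rw [N.measure_Ico μ hc h, mul_comm]
    congr 1
    have hint : IntervalIntegrable (fun r : ℝ => S.homDim * r ^ (S.homDim - 1)) volume (max a ρ) b :=
      Continuous.intervalIntegrable (by fun_prop) _ _
    rw [← intervalIntegral.integral_eq_sub_of_hasDerivAt (f := fun r : ℝ => r ^ S.homDim)
      (fun r _ => hasDerivAt_pow S.homDim r) hint, intervalIntegral.integral_of_le h,
      ← integral_Ico_eq_integral_Ioc, ofReal_integral_eq_lintegral_ofReal]
    · rw [intervalIntegrable_iff_integrableOn_Ico_of_le h] at hint
      exact hint
    · refine (ae_restrict_iff' measurableSet_Ico).2 (Eventually.of_forall fun r hr => ?_)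
      have : 0 < r := hc.trans_le hr.1
      positivity
  have h1 : ∫⁻ x in {x | ρ ≤ N.toFun x}, f (N.toFun x) ∂μ =
      ∫⁻ r in Set.Ici ρ, f r ∂(μ.map N.toFun) :=
    (setLIntegral_map measurableSet_Ici hf hN).symm
  rw [h1, hmeas, lintegral_smul_measure, lintegral_withDensity_eq_lintegral_mul _ hw hf, smul_eq_mul]
  rfl

end Stratification.HomogeneousNorm

end Carnot

/-! ### Orlicz functions: convexity, doubling and the tail integral. -/

namespace IsOrliczDensity

variable {a : ℝ → ℝ} (ha : IsOrliczDensity a)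

include ha

theorem nonneg {t : ℝ} (ht : 0 ≤ t) : 0 ≤ a t := by
  rcases ht.eq_or_lt with rfl | h
  · exact ha.zero.ge
  · exact (ha.pos t h).le

theorem intervalIntegrable {s t : ℝ} (hs : 0 ≤ s) (ht : 0 ≤ t) :
    IntervalIntegrable a volume s t := by
  refine (ha.mono.mono ?_).intervalIntegrable
  intro x hx
  exact (le_min hs ht).trans hx.1

theorem orlicz_sub {s t : ℝ} (hs : 0 ≤ s) (ht : 0 ≤ t) :
    orlicz a t - orlicz a s = ∫ τ in s..t, a τ :=
  intervalIntegral.integral_interval_sub_left (ha.intervalIntegrable le_rfl ht)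
    (ha.intervalIntegrable le_rfl hs)

theorem mul_le_orlicz_sub {s t : ℝ} (hs : 0 ≤ s) (hst : s ≤ t) :
    (t - s) * a s ≤ orlicz a t - orlicz a s := by
  rw [ha.orlicz_sub hs (hs.trans hst)]
  have h := intervalIntegral.integral_mono_on (f := fun _ => a s) hst (by simp)
    (ha.intervalIntegrable hs (hs.trans hst)) fun x hx => ha.mono hs (hs.trans hx.1) hx.1
  simpa using h

theorem orlicz_sub_le_mul {s t : ℝ} (hs : 0 ≤ s) (hst : s ≤ t) :
    orlicz a t - orlicz a s ≤ (t - s) * a t := by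
  rw [ha.orlicz_sub hs (hs.trans hst)]
  have h := intervalIntegral.integral_mono_on (g := fun _ => a t) hst
    (ha.intervalIntegrable hs (hs.trans hst)) (by simp)
    fun x hx => ha.mono (hs.trans hx.1) (hs.trans hst) hx.2
  simpa using h

omit ha in
@[simp]
theorem _root_.orlicz_zero : orlicz a 0 = 0 := by simp [orlicz]

theorem orlicz_mono {s t : ℝ} (hs : 0 ≤ s) (hst : s ≤ t) : orlicz a s ≤ orlicz a t := by
  have h1 := ha.mul_le_orlicz_sub hs hst
  have h2 := mul_nonneg (sub_nonneg.2 hst) (ha.nonneg hs)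
  linarith

theorem orlicz_nonneg {t : ℝ} (ht : 0 ≤ t) : 0 ≤ orlicz a t := by
  simpa using ha.orlicz_mono le_rfl ht

theorem orlicz_pos {t : ℝ} (ht : 0 < t) : 0 < orlicz a t := by
  have h1 := ha.mul_le_orlicz_sub (s := t / 2) (t := t) (by linarith) (by linarith)
  have h2 := mul_pos (show 0 < t - t / 2 by linarith) (ha.pos (t / 2) (by linarith))
  have h3 := ha.orlicz_nonneg (t := t / 2) (by linarith)
  linarith

theorem two_mul_orlicz_half_add_le {x y : ℝ} (hx : 0 ≤ x) (hy : 0 ≤ y) :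
    2 * orlicz a ((x + y) / 2) ≤ orlicz a x + orlicz a y := by
  wlog hxy : x ≤ y generalizing x y
  · rw [add_comm x, add_comm (orlicz a x)]
    exact this hy hx (le_of_not_ge hxy)
  have h1 := ha.orlicz_sub_le_mul hx (show x ≤ (x + y) / 2 by linarith)
  have h2 := ha.mul_le_orlicz_sub (show 0 ≤ (x + y) / 2 by linarith)
    (show (x + y) / 2 ≤ y by linarith)
  have h3 : (x + y) / 2 - x = y - (x + y) / 2 := by ring
  rw [h3] at h1
  linarith

theorem continuousOn_orlicz : ContinuousOn (orlicz a) (Set.Ici 0) := by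
  intro t ht
  have ht : 0 ≤ t := ht
  have h := intervalIntegral.continuousOn_primitive_interval' (a := 0)
    (ha.intervalIntegrable le_rfl (show 0 ≤ t + 1 by linarith)) (by simp)
  rw [Set.uIcc_of_le (by linarith)] at h
  refine (h t ⟨ht, by linarith⟩).mono_of_mem_nhdsWithin ?_
  rw [mem_nhdsWithin]
  exact ⟨Set.Iio (t + 1), isOpen_Iio, by simp, fun x hx => ⟨hx.2, le_of_lt hx.1⟩⟩

theorem continuous_orlicz_comp {X : Type*} [TopologicalSpace X] {f : X → ℝ} (hf : Continuous f)
    (h0 : ∀ x, 0 ≤ f x) : Continuous fun x => orlicz a (f x) :=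
  ha.continuousOn_orlicz.comp_continuous hf h0

theorem measurable_orlicz_comp {X : Type*} [MeasurableSpace X] {f : X → ℝ} (hf : Measurable f)
    (h0 : ∀ x, 0 ≤ f x) : Measurable fun x => orlicz a (f x) := by
  have h1 : Continuous fun x : ℝ => orlicz a |x| :=
    ha.continuous_orlicz_comp continuous_abs abs_nonneg
  have h2 : (fun x => orlicz a (f x)) = (fun x : ℝ => orlicz a |x|) ∘ f := by
    funext x; simp [abs_of_nonneg (h0 x)]
  rw [h2]
  exact h1.measurable.comp hf

theorem mul_orlicz_le {pm : ℝ} (hL : ∀ t : ℝ, 0 < t → pm ≤ t * a t / orlicz a t) {t : ℝ}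
    (ht : 0 ≤ t) : pm * orlicz a t ≤ t * a t := by
  rcases ht.eq_or_lt with rfl | h
  · simp
  · exact (le_div_iff₀ (ha.orlicz_pos h)).1 (hL t h)

theorem le_mul_orlicz {pp : ℝ} (hL : ∀ t : ℝ, 0 < t → t * a t / orlicz a t ≤ pp) {t : ℝ}
    (ht : 0 ≤ t) : t * a t ≤ pp * orlicz a t := by
  rcases ht.eq_or_lt with rfl | h
  · simp
  · exact (div_le_iff₀ (ha.orlicz_pos h)).1 (hL t h)

/-- This makes the set defining `delta2Const` nonempty, without which its infimum would be the
default value `0`. -/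
theorem exists_orlicz_two_mul_le {pp : ℝ} (hL : ∀ t : ℝ, 0 < t → t * a t / orlicz a t ≤ pp) :
    ∃ C : ℝ, 0 < C ∧ ∀ t, 0 ≤ t → orlicz a (2 * t) ≤ C * orlicz a t := by
  have hpp : 0 < pp := (div_pos (mul_pos one_pos (ha.pos 1 one_pos)) (ha.orlicz_pos one_pos)).trans_le
    (hL 1 one_pos)
  -- With `l` this close to `1`, `φ(t) - φ(lt) ≤ (1 - l) t a(t) ≤ φ(t)/2`. Shrinking by `l` then
  -- costs a factor at most `2`, and finitely many shrinkings go below `1/2`.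
  obtain ⟨l, hl0, hl1, hl⟩ : ∃ l : ℝ, 0 < l ∧ l < 1 ∧ pp * (1 - l) ≤ 1 / 2 := by
    refine ⟨1 - 1 / (2 * (pp + 1)), ?_, ?_, ?_⟩
    · rw [sub_pos, div_lt_one (by linarith)]; linarith
    · rw [sub_lt_self_iff]; positivity
    · rw [sub_sub_cancel, mul_one_div, div_le_div_iff₀ (by linarith) two_pos]; linarith
  have step : ∀ t, 0 ≤ t → orlicz a t ≤ 2 * orlicz a (l * t) := by
    intro t ht
    have h1 := ha.orlicz_sub_le_mul (mul_nonneg hl0.le ht) (show l * t ≤ t by nlinarith)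
    have h2 := mul_le_mul_of_nonneg_left (ha.le_mul_orlicz hL ht) (sub_nonneg.2 hl1.le)
    have h3 := mul_le_mul_of_nonneg_right hl (ha.orlicz_nonneg ht)
    nlinarith
  have iter : ∀ n : ℕ, ∀ t, 0 ≤ t → orlicz a t ≤ 2 ^ n * orlicz a (l ^ n * t) := by
    intro n
    induction n with
    | zero => intro t _; simp
    | succ n ih =>
      intro t ht
      have h1 := step (l ^ n * t) (by positivity)
      calc orlicz a t ≤ 2 ^ n * orlicz a (l ^ n * t) := ih t ht
        _ ≤ 2 ^ n * (2 * orlicz a (l * (l ^ n * t))) := by gcongr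
        _ = 2 ^ (n + 1) * orlicz a (l ^ (n + 1) * t) := by
          rw [← mul_assoc, ← pow_succ, ← mul_assoc, ← pow_succ']
  obtain ⟨n, hn⟩ := exists_pow_lt_of_lt_one (show (0 : ℝ) < 1 / 2 by norm_num) hl1
  refine ⟨2 ^ n, by positivity, fun t ht => (iter n (2 * t) (by linarith)).trans ?_⟩
  refine mul_le_mul_of_nonneg_left (ha.orlicz_mono (by positivity) ?_) (by positivity)
  nlinarith

/-- The infimum is attained: for each `t > 0` the ratio `φ(2t)/φ(t)` is a lower bound of the
admissible constants. -/
theorem orlicz_two_mul_le {pp : ℝ} (hL : ∀ t : ℝ, 0 < t → t * a t / orlicz a t ≤ pp) {t : ℝ}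
    (ht : 0 ≤ t) : orlicz a (2 * t) ≤ delta2Const (orlicz a) * orlicz a t := by
  rcases ht.eq_or_lt with rfl | h
  · simp
  rw [← div_le_iff₀ (ha.orlicz_pos h)]
  exact le_csInf (ha.exists_orlicz_two_mul_le hL) fun C hC =>
    (div_le_iff₀ (ha.orlicz_pos h)).2 (hC.2 t ht)

theorem delta2Const_pos {pp : ℝ} (hL : ∀ t : ℝ, 0 < t → t * a t / orlicz a t ≤ pp) :
    0 < delta2Const (orlicz a) := by
  have h := ha.orlicz_two_mul_le hL (t := 1) zero_le_one
  have h1 := ha.orlicz_pos (t := 1) one_pos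
  have h2 := ha.orlicz_pos (t := 2 * 1) (by norm_num)
  exact pos_of_mul_pos_left (h2.trans_le h) h1.le

/-- Doubling at the midpoint, then midpoint convexity. Convexity supplies the factor `1/2`, which
gives the constants `C` and `4/C` of the final bounds. -/
theorem orlicz_add_le {pp : ℝ} (hL : ∀ t : ℝ, 0 < t → t * a t / orlicz a t ≤ pp) {x y : ℝ}
    (hx : 0 ≤ x) (hy : 0 ≤ y) :
    orlicz a (x + y) ≤ delta2Const (orlicz a) / 2 * (orlicz a x + orlicz a y) := by
  have h1 := ha.orlicz_two_mul_le hL (t := (x + y) / 2) (by positivity)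
  rw [mul_div_cancel₀ _ (two_ne_zero' ℝ)] at h1
  have h2 := mul_le_mul_of_nonneg_left (ha.two_mul_orlicz_half_add_le hx hy)
    (ha.delta2Const_pos hL).le
  linarith

/-- The change of variables `τ = t / r ^ s` in `φ(t / ρ ^ s) = ∫ a(τ) dτ`. -/
theorem ofReal_orlicz_eq_setLIntegral {t ρ s : ℝ} (ht : 0 < t) (hρ : 0 < ρ) (hs : 0 < s) :
    ENNReal.ofReal (orlicz a (t / ρ ^ s)) =
      ∫⁻ r in Set.Ici ρ, ENNReal.ofReal (s * (t / r ^ s * a (t / r ^ s)) / r) := by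
  set T := t / ρ ^ s with hT
  have hT0 : 0 < T := by positivity
  have h1 : ENNReal.ofReal (orlicz a T) = ∫⁻ τ in Set.Ioc 0 T, ENNReal.ofReal (a τ) := by
    rw [orlicz, intervalIntegral.integral_of_le hT0.le, ofReal_integral_eq_lintegral_ofReal]
    · exact (intervalIntegrable_iff_integrableOn_Ioc_of_le hT0.le).1
        (ha.intervalIntegrable le_rfl hT0.le)
    · exact (ae_restrict_iff' measurableSet_Ioc).2
        (Eventually.of_forall fun τ hτ => ha.nonneg hτ.1.le)
  let g : ℝ → ℝ := fun r => t * r ^ (-s)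
  have hg : ∀ r, 0 < r → g r = t / r ^ s := fun r hr => by
    simp only [g, Real.rpow_neg hr.le, div_eq_mul_inv]
  -- `r ↦ t / r ^ s` decreases from `T` at `r = ρ` to `0` at infinity, and its derivative has
  -- absolute value `s τ / r`.
  have himg : g '' Set.Ici ρ = Set.Ioc 0 T := by
    ext τ
    constructor
    · rintro ⟨r, hr, rfl⟩
      have hr' : ρ ≤ r := hr
      have hr0 : 0 < r := hρ.trans_le hr'
      rw [hg r hr0]
      exact ⟨by positivity, by rw [hT]; gcongr⟩
    · rintro ⟨h0, h1⟩
      have hτ : ρ ^ s ≤ t / τ := by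
        rw [hT, le_div_iff₀ (by positivity)] at h1
        rw [le_div_iff₀ h0]
        linarith
      refine ⟨(t / τ) ^ s⁻¹, ?_, ?_⟩
      · have := Real.rpow_le_rpow (by positivity) hτ (inv_nonneg.2 hs.le)
        rwa [Real.rpow_rpow_inv hρ.le hs.ne'] at this
      · rw [hg _ (by positivity), Real.rpow_inv_rpow (by positivity) hs.ne']
        field_simp
  have hinj : Set.InjOn g (Set.Ici ρ) := by
    intro r hr r' hr' h
    have hr0 : 0 < r := hρ.trans_le hr
    have hr0' : 0 < r' := hρ.trans_le hr'
    have h2 : r ^ (-s) = r' ^ (-s) := mul_left_cancel₀ ht.ne' h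
    exact (Real.rpow_left_inj hr0.le hr0'.le (neg_ne_zero.2 hs.ne')).1 h2
  rw [h1, ← himg, lintegral_image_eq_lintegral_abs_deriv_mul measurableSet_Ici
    (f' := fun r => t * (-s * r ^ (-s - 1))) ?_ hinj]
  · refine setLIntegral_congr_fun measurableSet_Ici fun r hr => ?_
    have hr0 : 0 < r := hρ.trans_le hr
    rw [← ENNReal.ofReal_mul (abs_nonneg _), hg r hr0]
    congr 1
    rw [show t * (-s * r ^ (-s - 1)) = -(s * (t / r ^ s) / r) by
      rw [Real.rpow_sub_one hr0.ne', Real.rpow_neg hr0.le]; ring, abs_neg, abs_of_nonneg (by positivity)]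
    ring
  · intro r hr
    have hr0 : 0 < r := hρ.trans_le hr
    exact ((Real.hasDerivAt_rpow_const (Or.inl hr0.ne')).const_mul t).hasDerivWithinAt

theorem mul_setLIntegral_orlicz_le {pm : ℝ} (hpm : 0 ≤ pm)
    (hL : ∀ t : ℝ, 0 < t → pm ≤ t * a t / orlicz a t)
    {t ρ s : ℝ} (ht : 0 ≤ t) (hρ : 0 < ρ) (hs : 0 < s) :
    ENNReal.ofReal (s * pm) * ∫⁻ r in Set.Ici ρ, ENNReal.ofReal (orlicz a (t / r ^ s) / r) ≤
      ENNReal.ofReal (orlicz a (t / ρ ^ s)) := by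
  rcases ht.eq_or_lt with rfl | ht
  · simp
  rw [ha.ofReal_orlicz_eq_setLIntegral ht hρ hs, ← lintegral_const_mul' _ _ ENNReal.ofReal_ne_top]
  refine setLIntegral_mono' measurableSet_Ici fun r hr => ?_
  have hr0 : 0 < r := hρ.trans_le hr
  rw [← ENNReal.ofReal_mul (by positivity)]
  refine ENNReal.ofReal_le_ofReal ?_
  have := ha.mul_orlicz_le hL (t := t / r ^ s) (by positivity)
  rw [← mul_div_assoc, mul_assoc]
  gcongr

theorem le_mul_setLIntegral_orlicz {pp : ℝ} (hpp : 0 ≤ pp)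
    (hL : ∀ t : ℝ, 0 < t → t * a t / orlicz a t ≤ pp)
    {t ρ s : ℝ} (ht : 0 ≤ t) (hρ : 0 < ρ) (hs : 0 < s) :
    ENNReal.ofReal (orlicz a (t / ρ ^ s)) ≤
      ENNReal.ofReal (s * pp) * ∫⁻ r in Set.Ici ρ, ENNReal.ofReal (orlicz a (t / r ^ s) / r) := by
  rcases ht.eq_or_lt with rfl | ht
  · simp
  rw [ha.ofReal_orlicz_eq_setLIntegral ht hρ hs, ← lintegral_const_mul' _ _ ENNReal.ofReal_ne_top]
  refine setLIntegral_mono' measurableSet_Ici fun r hr => ?_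
  have hr0 : 0 < r := hρ.trans_le hr
  rw [← ENNReal.ofReal_mul (by positivity)]
  refine ENNReal.ofReal_le_ofReal ?_
  have := ha.le_mul_orlicz hL (t := t / r ^ s) (by positivity)
  rw [← mul_div_assoc, mul_assoc]
  gcongr

end IsOrliczDensity

/-! ### The kernel: pointwise inequalities and tail integrals. -/

namespace Carnot

variable {𝔤 : Type*} [LieRing 𝔤] [LieAlgebra ℝ 𝔤] [TopologicalSpace 𝔤]
  {S : Stratification 𝔤} (N : S.HomogeneousNorm)

/-- The integrand `φ(|t| / ‖w‖ ^ s) / ‖w‖ ^ Q` of the fractional modular. -/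
def fracKernel (φ : ℝ → ℝ) (s t : ℝ) (w : 𝔤) : ℝ≥0∞ :=
  ENNReal.ofReal (φ (|t| / N.toFun w ^ s) / N.toFun w ^ S.homDim)

theorem fracModular_eq [MeasurableSpace 𝔤] (μ : Measure 𝔤) (φ : ℝ → ℝ) (s : ℝ) (u : 𝔤 → ℝ) :
    fracModular N μ φ s u =
      ∫⁻ z : 𝔤 × 𝔤, fracKernel N φ s (u z.1 - u z.2) (S.mul (-z.2) z.1) ∂(μ.prod μ) := rfl

theorem fracKernel_sub_comm (φ : ℝ → ℝ) (s t t' : ℝ) (w : 𝔤) :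
    fracKernel N φ s (t - t') w = fracKernel N φ s (t' - t) w := by
  rw [fracKernel, abs_sub_comm, fracKernel]

section Kernel

theorem abs_div_rpow_nonneg (s t : ℝ) (w : 𝔤) : 0 ≤ |t| / N.toFun w ^ s :=
  div_nonneg (abs_nonneg _) (Real.rpow_nonneg (N.nonneg' w) _)

variable {a : ℝ → ℝ} (ha : IsOrliczDensity a)

include ha

theorem measurable_fracKernel [MeasurableSpace 𝔤] [BorelSpace 𝔤] (s : ℝ) :
    Measurable fun p : ℝ × 𝔤 => fracKernel N (orlicz a) s p.1 p.2 := by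
  have hN : Measurable fun p : ℝ × 𝔤 => N.toFun p.2 := N.continuous'.measurable.comp measurable_snd
  refine ENNReal.measurable_ofReal.comp (Measurable.div ?_ (hN.pow_const _))
  refine ha.measurable_orlicz_comp (f := fun p : ℝ × 𝔤 => |p.1| / N.toFun p.2 ^ s) ?_
    fun p => abs_div_rpow_nonneg N s p.1 p.2
  exact (measurable_norm.comp measurable_fst).div (hN.pow_const s)

theorem fracKernel_mono {s s' : ℝ} (hs : 0 < s) (hss' : s ≤ s') (t : ℝ) {w : 𝔤}
    (hw : N.toFun w ≤ 1) : fracKernel N (orlicz a) s t w ≤ fracKernel N (orlicz a) s' t w := by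
  refine ENNReal.ofReal_le_ofReal ?_
  -- On the diagonal `0 ^ s = 0` for both orders, and the two kernels coincide.
  rcases (N.nonneg' w).eq_or_lt with h | h
  · rw [← h, Real.zero_rpow hs.ne', Real.zero_rpow (hs.trans_le hss').ne']
  · have h1 := Real.rpow_le_rpow_of_exponent_ge h hw hss'
    have h2 : 0 < N.toFun w ^ s' := Real.rpow_pos_of_pos h _
    refine div_le_div_of_nonneg_right ?_ (pow_nonneg (N.nonneg' w) _)
    exact ha.orlicz_mono (abs_div_rpow_nonneg N s t w) (by gcongr)

variable {pp : ℝ} (hpp : ∀ t : ℝ, 0 < t → t * a t / orlicz a t ≤ pp)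

include hpp

theorem fracKernel_add_le (s t t' : ℝ) (w : 𝔤) :
    fracKernel N (orlicz a) s (t + t') w ≤ ENNReal.ofReal (delta2Const (orlicz a) / 2) *
      (fracKernel N (orlicz a) s t w + fracKernel N (orlicz a) s t' w) := by
  have hC := ha.delta2Const_pos hpp
  have hQ : 0 ≤ N.toFun w ^ S.homDim := pow_nonneg (N.nonneg' w) _
  have h1 := abs_div_rpow_nonneg N s t w
  have h2 := abs_div_rpow_nonneg N s t' w
  simp only [fracKernel]
  rw [← ENNReal.ofReal_add (div_nonneg (ha.orlicz_nonneg h1) hQ)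
    (div_nonneg (ha.orlicz_nonneg h2) hQ), ← ENNReal.ofReal_mul (by positivity), ← add_div,
    ← mul_div_assoc]
  refine ENNReal.ofReal_le_ofReal (div_le_div_of_nonneg_right ?_ hQ)
  refine le_trans ?_ (ha.orlicz_add_le hpp h1 h2)
  refine ha.orlicz_mono (abs_div_rpow_nonneg N s _ w) ?_
  rw [← add_div]
  exact div_le_div_of_nonneg_right (abs_add_le t t') (Real.rpow_nonneg (N.nonneg' w) _)

theorem fracKernel_sub_le (s t t' : ℝ) (w : 𝔤) :
    fracKernel N (orlicz a) s (t - t') w ≤ ENNReal.ofReal (delta2Const (orlicz a) / 2) *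
      (fracKernel N (orlicz a) s t w + fracKernel N (orlicz a) s t' w) := by
  have h := fracKernel_add_le N ha hpp s t (-t') w
  rwa [← sub_eq_add_neg, show fracKernel N (orlicz a) s (-t') w = fracKernel N (orlicz a) s t' w by
    simp only [fracKernel, abs_neg]] at h

/-- Subadditivity up to `C/2` for `t = (t - t') + t'`, divided by `C/2`. It bounds the kernel of a
difference from below. -/
theorem mul_fracKernel_le (s t t' : ℝ) (w : 𝔤) :
    ENNReal.ofReal (2 / delta2Const (orlicz a)) * fracKernel N (orlicz a) s t w ≤
      fracKernel N (orlicz a) s (t - t') w + fracKernel N (orlicz a) s t' w := by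
  have hC := ha.delta2Const_pos hpp
  have h := fracKernel_add_le N ha hpp s (t - t') t' w
  rw [sub_add_cancel] at h
  refine (mul_le_mul_right h _).trans_eq ?_
  rw [← mul_assoc, ← ENNReal.ofReal_mul (by positivity), div_mul_div_cancel₀ hC.ne']
  simp

end Kernel

section Integrals

variable [FiniteDimensional ℝ 𝔤] [IsTopologicalAddGroup 𝔤] [ContinuousSMul ℝ 𝔤] [T2Space 𝔤]
    [MeasurableSpace 𝔤] [BorelSpace 𝔤] (μ : Measure 𝔤) [μ.IsAddHaarMeasure]

variable (S) in
theorem measurable_neg_mul : Measurable fun z : 𝔤 × 𝔤 => S.mul (-z.2) z.1 := by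
  have := secondCountableTopology_of_finiteDimensional 𝔤
  have h : Continuous fun z : 𝔤 × 𝔤 => (-z.2, z.1) := by fun_prop
  have h2 := S.continuous_mul.comp h
  exact h2.measurable

variable (S) in
theorem lintegral_prod_fst_neg_mul {H : 𝔤 × 𝔤 → ℝ≥0∞} (hH : Measurable H) :
    ∫⁻ z : 𝔤 × 𝔤, H (z.1, S.mul (-z.2) z.1) ∂(μ.prod μ) = ∫⁻ x, ∫⁻ w, H (x, w) ∂μ ∂μ := by
  have := secondCountableTopology_of_finiteDimensional 𝔤
  have := locallyCompactSpace_of_finiteDimensional 𝔤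
  rw [lintegral_prod (fun z : 𝔤 × 𝔤 => H (z.1, S.mul (-z.2) z.1))
    (hH.comp (measurable_fst.prodMk (measurable_neg_mul S))).aemeasurable]
  refine lintegral_congr fun x => ?_
  exact (S.measurePreserving_neg_mul μ x).lintegral_comp (hH.comp measurable_prodMk_left)

variable (S) in
theorem lintegral_prod_snd_neg_mul {H : 𝔤 × 𝔤 → ℝ≥0∞} (hH : Measurable H) :
    ∫⁻ z : 𝔤 × 𝔤, H (z.2, S.mul (-z.2) z.1) ∂(μ.prod μ) = ∫⁻ y, ∫⁻ w, H (y, w) ∂μ ∂μ := by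
  have := secondCountableTopology_of_finiteDimensional 𝔤
  have := locallyCompactSpace_of_finiteDimensional 𝔤
  rw [lintegral_prod_symm (fun z : 𝔤 × 𝔤 => H (z.2, S.mul (-z.2) z.1))
    (hH.comp (measurable_snd.prodMk (measurable_neg_mul S))).aemeasurable]
  refine lintegral_congr fun y => ?_
  exact (S.measurePreserving_mul_left μ (-y)).lintegral_comp (hH.comp measurable_prodMk_left)

variable {a : ℝ → ℝ} (ha : IsOrliczDensity a)

include ha

/-- The polar density `Q r^(Q-1)` against the weight `r^(-Q)` leaves `Q/r`. -/
theorem setLIntegral_fracKernel (s t : ℝ) {ρ : ℝ} (hρ : 0 < ρ) :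
    ∫⁻ w in {w | ρ ≤ N.toFun w}, fracKernel N (orlicz a) s t w ∂μ =
      (S.homDim : ℝ≥0∞) * ballMeasure N μ *
        ∫⁻ r in Set.Ici ρ, ENNReal.ofReal (orlicz a (|t| / r ^ s) / r) := by
  let f : ℝ → ℝ≥0∞ := fun r => ENNReal.ofReal (orlicz a |(|t| / r ^ s)| / r ^ S.homDim)
  have hf : Measurable f := by
    refine ENNReal.measurable_ofReal.comp (Measurable.div ?_ (by fun_prop))
    exact ha.measurable_orlicz_comp (f := fun r : ℝ => |(|t| / r ^ s)|) (by fun_prop)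
      fun _ => abs_nonneg _
  have h1 : ∀ w, fracKernel N (orlicz a) s t w = f (N.toFun w) := fun w => by
    simp only [fracKernel, f]
    rw [abs_of_nonneg (abs_div_rpow_nonneg N s t w)]
  simp only [h1]
  rw [N.setLIntegral_comp μ hρ hf, mul_comm (S.homDim : ℝ≥0∞), mul_assoc,
    ← lintegral_const_mul' _ _ (ENNReal.natCast_ne_top _)]
  congr 1
  refine setLIntegral_congr_fun measurableSet_Ici fun r hr => ?_
  have hr0 : 0 < r := hρ.trans_le hr
  rw [← ENNReal.ofReal_natCast, ← ENNReal.ofReal_mul (by positivity),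
    ← ENNReal.ofReal_mul (by positivity), abs_of_nonneg (by positivity)]
  congr 1
  rcases Nat.eq_zero_or_pos S.homDim with h | h
  · simp [h]
  · have : r ^ S.homDim = r ^ (S.homDim - 1) * r := (pow_sub_one_mul h.ne' r).symm
    rw [this]
    field_simp

theorem mul_setLIntegral_fracKernel_le {pm : ℝ} (hpm : 0 < pm)
    (hL : ∀ t : ℝ, 0 < t → pm ≤ t * a t / orlicz a t) {s : ℝ} (hs : 0 < s) (t : ℝ) {ρ : ℝ}
    (hρ : 0 < ρ) :
    ENNReal.ofReal s * ∫⁻ w in {w | ρ ≤ N.toFun w}, fracKernel N (orlicz a) s t w ∂μ ≤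
      (S.homDim : ℝ≥0∞) * ballMeasure N μ / ENNReal.ofReal pm *
        ENNReal.ofReal (orlicz a (|t| / ρ ^ s)) := by
  rw [setLIntegral_fracKernel N μ ha s t hρ]
  set X := ∫⁻ r in Set.Ici ρ, ENNReal.ofReal (orlicz a (|t| / r ^ s) / r)
  have h : ENNReal.ofReal (s * pm) * X ≤ _ :=
    ha.mul_setLIntegral_orlicz_le hpm.le hL (abs_nonneg t) hρ hs
  rw [ENNReal.ofReal_mul hs.le] at h
  have hp0 : ENNReal.ofReal pm ≠ 0 := by simpa using hpm
  calc ENNReal.ofReal s * ((S.homDim : ℝ≥0∞) * ballMeasure N μ * X)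
      = (S.homDim : ℝ≥0∞) * ballMeasure N μ / ENNReal.ofReal pm *
        (ENNReal.ofReal s * ENNReal.ofReal pm * X) := by
        rw [div_eq_mul_inv]
        calc _ = (ENNReal.ofReal pm * (ENNReal.ofReal pm)⁻¹) *
              (ENNReal.ofReal s * ((S.homDim : ℝ≥0∞) * ballMeasure N μ * X)) := by
              rw [ENNReal.mul_inv_cancel hp0 ENNReal.ofReal_ne_top, one_mul]
          _ = _ := by ring
    _ ≤ _ := mul_le_mul_right h _

theorem le_mul_setLIntegral_fracKernel {pp : ℝ} (hpp : 0 < pp)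
    (hL : ∀ t : ℝ, 0 < t → t * a t / orlicz a t ≤ pp) {s : ℝ} (hs : 0 < s) (t : ℝ) {ρ : ℝ}
    (hρ : 0 < ρ) :
    (S.homDim : ℝ≥0∞) * ballMeasure N μ / ENNReal.ofReal pp *
        ENNReal.ofReal (orlicz a (|t| / ρ ^ s)) ≤
      ENNReal.ofReal s * ∫⁻ w in {w | ρ ≤ N.toFun w}, fracKernel N (orlicz a) s t w ∂μ := by
  rw [setLIntegral_fracKernel N μ ha s t hρ]
  set X := ∫⁻ r in Set.Ici ρ, ENNReal.ofReal (orlicz a (|t| / r ^ s) / r)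
  have h : _ ≤ ENNReal.ofReal (s * pp) * X :=
    ha.le_mul_setLIntegral_orlicz hpp.le hL (abs_nonneg t) hρ hs
  rw [ENNReal.ofReal_mul hs.le] at h
  have hp0 : ENNReal.ofReal pp ≠ 0 := by simpa using hpp
  calc _ ≤ (S.homDim : ℝ≥0∞) * ballMeasure N μ / ENNReal.ofReal pp *
        (ENNReal.ofReal s * ENNReal.ofReal pp * X) := mul_le_mul_right h _
    _ = _ := by
        rw [div_eq_mul_inv]
        calc _ = (ENNReal.ofReal pp * (ENNReal.ofReal pp)⁻¹) *
              (ENNReal.ofReal s * ((S.homDim : ℝ≥0∞) * ballMeasure N μ * X)) := by ring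
          _ = _ := by rw [ENNReal.mul_inv_cancel hp0 ENNReal.ofReal_ne_top, one_mul]

/-- The contribution of the points close to the origin relative to a far point `y`. -/
theorem lintegral_indicator_fracKernel_le {s : ℝ} (hs : 0 < s) (t : ℝ) (y : 𝔤) {m : 𝔤 → 𝔤}
    (hm : ∀ x, N.toFun y - N.toFun x ≤ N.toFun (m x)) :
    ∫⁻ x, {x | 2 ≤ N.toFun y ∧ 2 * N.toFun x < N.toFun y}.indicator
        (fun x => fracKernel N (orlicz a) s t (m x)) x ∂μ ≤
      ballMeasure N μ * ENNReal.ofReal (orlicz a |t|) := by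
  rcases lt_or_ge (N.toFun y) 2 with hy | hy
  · simp [not_le.2 hy]
  set r := N.toFun y / 2 with hr
  have hr1 : 1 ≤ r := by rw [hr]; linarith
  have hr0 : 0 < r := by linarith
  -- With `r = ‖y‖/2 ≥ 1`, each admissible `x` lies in the ball of radius `r` while `‖m x‖ ≥ r`. The
  -- integrand is at most `φ(|t|)/r^Q` on a set of measure at most `C_b r^Q`, so `r` cancels.
  calc _ ≤ ∫⁻ x, {x | N.toFun x < r}.indicator
        (fun _ => ENNReal.ofReal (orlicz a |t| / r ^ S.homDim)) x ∂μ := by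
        refine lintegral_mono fun x => ?_
        refine Set.indicator_le_indicator' ?_ |>.trans (Set.indicator_le_indicator_of_subset ?_
          (fun _ => zero_le) x)
        · rintro ⟨-, hx⟩
          have hw : r ≤ N.toFun (m x) := by linarith [hm x]
          refine ENNReal.ofReal_le_ofReal ?_
          have h1 : 1 ≤ N.toFun (m x) ^ s := Real.one_le_rpow (hr1.trans hw) hs.le
          have h2 := ha.orlicz_nonneg (abs_nonneg t)
          have h3 : orlicz a (|t| / N.toFun (m x) ^ s) ≤ orlicz a |t| :=
            ha.orlicz_mono (abs_div_rpow_nonneg N s t _) (div_le_self (abs_nonneg t) h1)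
          gcongr
        · rintro x ⟨-, hx⟩
          change N.toFun x < r
          linarith
    _ = ENNReal.ofReal (orlicz a |t| / r ^ S.homDim) *
          (ENNReal.ofReal (r ^ S.homDim) * ballMeasure N μ) := by
        rw [lintegral_indicator_const (N.measurableSet_lt r), N.measure_lt μ hr0]
    _ = _ := by
        rw [← mul_assoc, ← ENNReal.ofReal_mul (div_nonneg (ha.orlicz_nonneg (abs_nonneg t))
          (by positivity)), div_mul_cancel₀ _ (by positivity), mul_comm]

end Integrals

end Carnot

/-! ### The two bounds at a fixed order. -/

namespace Carnot

variable {𝔤 : Type*} [LieRing 𝔤] [LieAlgebra ℝ 𝔤] [TopologicalSpace 𝔤]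
  {S : Stratification 𝔤} (N : S.HomogeneousNorm)

/-- The part at distance at least `ρ` from the diagonal of the integrand of the fractional modular,
with `u` set to zero at one of the two points. -/
def farKernel (φ : ℝ → ℝ) (s : ℝ) (u ρ : 𝔤 → ℝ) (p : 𝔤 × 𝔤) : ℝ≥0∞ :=
  {p : 𝔤 × 𝔤 | ρ p.1 ≤ N.toFun p.2}.indicator (fun p => fracKernel N φ s (u p.1) p.2) p

variable [FiniteDimensional ℝ 𝔤] [IsTopologicalAddGroup 𝔤] [ContinuousSMul ℝ 𝔤] [T2Space 𝔤]
    [MeasurableSpace 𝔤] [BorelSpace 𝔤] (μ : Measure 𝔤) [μ.IsAddHaarMeasure]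
    {a : ℝ → ℝ} (ha : IsOrliczDensity a) {u : 𝔤 → ℝ} (hu : Measurable u)

omit [FiniteDimensional ℝ 𝔤] [IsTopologicalAddGroup 𝔤] [ContinuousSMul ℝ 𝔤] [T2Space 𝔤] in
include ha hu in
theorem measurable_farKernel (s : ℝ) {ρ : 𝔤 → ℝ} (hρ : Measurable ρ) :
    Measurable (farKernel N (orlicz a) s u ρ) := by
  have h1 : Measurable fun p : 𝔤 × 𝔤 => (u p.1, p.2) :=
    (hu.comp measurable_fst).prodMk measurable_snd
  have h2 := (measurable_fracKernel N ha s).comp h1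
  have h3 : MeasurableSet {p : 𝔤 × 𝔤 | ρ p.1 ≤ N.toFun p.2} :=
    measurableSet_le (hρ.comp measurable_fst) (N.continuous'.measurable.comp measurable_snd)
  exact h2.indicator h3

omit [FiniteDimensional ℝ 𝔤] [IsTopologicalAddGroup 𝔤] [ContinuousSMul ℝ 𝔤] [T2Space 𝔤]
  [μ.IsAddHaarMeasure] in
theorem lintegral_farKernel (φ : ℝ → ℝ) (s : ℝ) (u ρ : 𝔤 → ℝ) (x : 𝔤) :
    ∫⁻ w, farKernel N φ s u ρ (x, w) ∂μ =
      ∫⁻ w in {w | ρ x ≤ N.toFun w}, fracKernel N φ s (u x) w ∂μ := by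
  rw [← lintegral_indicator (measurableSet_le measurable_const N.continuous'.measurable)]
  rfl

theorem homDim_mul_ballMeasure_div_ne_top {p : ℝ} (hp : 0 < p) :
    (S.homDim : ℝ≥0∞) * ballMeasure N μ / ENNReal.ofReal p ≠ ∞ :=
  ENNReal.div_ne_top (ENNReal.mul_ne_top (ENNReal.natCast_ne_top _) (N.ballMeasure_lt_top μ).ne)
    (by simpa using hp)

include ha in
theorem mul_lintegral_farKernel_le {pm : ℝ} (hpm : 0 < pm)
    (hL : ∀ t : ℝ, 0 < t → pm ≤ t * a t / orlicz a t) {s : ℝ} (hs : 0 < s) {ρ : 𝔤 → ℝ}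
    (hρ : ∀ x, 0 < ρ x) :
    ENNReal.ofReal s * ∫⁻ x, ∫⁻ w, farKernel N (orlicz a) s u ρ (x, w) ∂μ ∂μ ≤
      (S.homDim : ℝ≥0∞) * ballMeasure N μ / ENNReal.ofReal pm *
        ∫⁻ x, ENNReal.ofReal (orlicz a (|u x| / ρ x ^ s)) ∂μ := by
  rw [← lintegral_const_mul' _ _ ENNReal.ofReal_ne_top,
    ← lintegral_const_mul' _ _ (homDim_mul_ballMeasure_div_ne_top N μ hpm)]
  refine lintegral_mono fun x => ?_
  rw [lintegral_farKernel]
  exact mul_setLIntegral_fracKernel_le N μ ha hpm hL hs (u x) (hρ x)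

include ha in
theorem le_mul_lintegral_farKernel {pp : ℝ} (hpp : 0 < pp)
    (hL : ∀ t : ℝ, 0 < t → t * a t / orlicz a t ≤ pp) {s : ℝ} (hs : 0 < s) {ρ : 𝔤 → ℝ}
    (hρ : ∀ x, 0 < ρ x) :
    (S.homDim : ℝ≥0∞) * ballMeasure N μ / ENNReal.ofReal pp *
        ∫⁻ x, ENNReal.ofReal (orlicz a (|u x| / ρ x ^ s)) ∂μ ≤
      ENNReal.ofReal s * ∫⁻ x, ∫⁻ w, farKernel N (orlicz a) s u ρ (x, w) ∂μ ∂μ := by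
  rw [← lintegral_const_mul' _ _ ENNReal.ofReal_ne_top,
    ← lintegral_const_mul' _ _ (homDim_mul_ballMeasure_div_ne_top N μ hpp)]
  refine lintegral_mono fun x => ?_
  rw [lintegral_farKernel]
  exact le_mul_setLIntegral_fracKernel N μ ha hpp hL hs (u x) (hρ x)

include ha hu in
/-- The bound from above at a fixed order `s`. -/
theorem mul_fracModular_le {pm pp : ℝ} (hpm : 0 < pm)
    (hm : ∀ t : ℝ, 0 < t → pm ≤ t * a t / orlicz a t)
    (hp : ∀ t : ℝ, 0 < t → t * a t / orlicz a t ≤ pp) {s s₀ : ℝ} (hs : 0 < s) (hss : s ≤ s₀) :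
    ENNReal.ofReal s * fracModular N μ (orlicz a) s u ≤
      ENNReal.ofReal s * fracModular N μ (orlicz a) s₀ u +
        ENNReal.ofReal (delta2Const (orlicz a)) *
          ((S.homDim : ℝ≥0∞) * ballMeasure N μ / ENNReal.ofReal pm) *
          orliczModular μ (orlicz a) u := by
  have hC := ha.delta2Const_pos hp
  set C := delta2Const (orlicz a)
  let G := farKernel N (orlicz a) s u fun _ => 1
  have hG : Measurable G := measurable_farKernel N ha hu s measurable_const
  have hz1 : Measurable fun z : 𝔤 × 𝔤 => G (z.1, S.mul (-z.2) z.1) :=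
    hG.comp (measurable_fst.prodMk (measurable_neg_mul S))
  have hz2 : Measurable fun z : 𝔤 × 𝔤 => G (z.2, S.mul (-z.2) z.1) :=
    hG.comp (measurable_snd.prodMk (measurable_neg_mul S))
  have hz12 : Measurable fun z : 𝔤 × 𝔤 =>
      G (z.1, S.mul (-z.2) z.1) + G (z.2, S.mul (-z.2) z.1) := hz1.add hz2
  -- Near the diagonal order `s₀` dominates order `s`; away from it the difference is split into the
  -- two values.
  have hpt : ∀ z : 𝔤 × 𝔤, fracKernel N (orlicz a) s (u z.1 - u z.2) (S.mul (-z.2) z.1) ≤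
      fracKernel N (orlicz a) s₀ (u z.1 - u z.2) (S.mul (-z.2) z.1) +
        ENNReal.ofReal (C / 2) * (G (z.1, S.mul (-z.2) z.1) + G (z.2, S.mul (-z.2) z.1)) := by
    intro z
    rcases lt_or_ge (N.toFun (S.mul (-z.2) z.1)) 1 with h | h
    · exact le_add_right (fracKernel_mono N ha hs hss _ h.le)
    · refine le_add_left ((fracKernel_sub_le N ha hp s _ _ _).trans_eq ?_)
      have hG1 : ∀ x, G (x, S.mul (-z.2) z.1) =
          fracKernel N (orlicz a) s (u x) (S.mul (-z.2) z.1) := fun x =>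
        Set.indicator_of_mem (s := {p : 𝔤 × 𝔤 | 1 ≤ N.toFun p.2}) h _
      rw [hG1, hG1]
  have hint : fracModular N μ (orlicz a) s u ≤ fracModular N μ (orlicz a) s₀ u +
      ENNReal.ofReal C * ∫⁻ x, ∫⁻ w, G (x, w) ∂μ ∂μ := by
    simp only [fracModular_eq]
    refine (lintegral_mono hpt).trans_eq ?_
    rw [lintegral_add_right _ (hz12.const_mul _), lintegral_const_mul _ hz12,
      lintegral_add_left hz1, lintegral_prod_fst_neg_mul S μ hG, lintegral_prod_snd_neg_mul S μ hG,
      ← two_mul, ← mul_assoc, show (2 : ℝ≥0∞) = ENNReal.ofReal 2 by simp,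
      ← ENNReal.ofReal_mul (by positivity), div_mul_cancel₀ _ two_ne_zero]
  have hfar := mul_lintegral_farKernel_le N μ ha (u := u) hpm hm hs (ρ := fun _ => 1)
    fun _ => one_pos
  simp only [Real.one_rpow, div_one] at hfar
  calc _ ≤ ENNReal.ofReal s * (fracModular N μ (orlicz a) s₀ u +
      ENNReal.ofReal C * ∫⁻ x, ∫⁻ w, G (x, w) ∂μ ∂μ) := mul_le_mul_right hint _
    _ = ENNReal.ofReal s * fracModular N μ (orlicz a) s₀ u +
      ENNReal.ofReal C * (ENNReal.ofReal s * ∫⁻ x, ∫⁻ w, G (x, w) ∂μ ∂μ) := by ring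
    _ ≤ _ := by
      rw [mul_assoc (ENNReal.ofReal C)]
      exact add_le_add_right (mul_le_mul_right hfar _) _

include ha hu in
/-- The bound from below at a fixed order `s`. -/
theorem le_mul_fracModular_add {pp : ℝ} (hpp : 0 < pp)
    (hp : ∀ t : ℝ, 0 < t → t * a t / orlicz a t ≤ pp) {s : ℝ} (hs : 0 < s) :
    ENNReal.ofReal (4 / delta2Const (orlicz a)) *
        ((S.homDim : ℝ≥0∞) * ballMeasure N μ / ENNReal.ofReal pp) *
          ∫⁻ x, ENNReal.ofReal (orlicz a (|u x| / (2 + 3 * N.toFun x) ^ s)) ∂μ ≤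
      ENNReal.ofReal s * fracModular N μ (orlicz a) s u +
        ENNReal.ofReal s * (2 * (ballMeasure N μ * orliczModular μ (orlicz a) u)) := by
  have := secondCountableTopology_of_finiteDimensional 𝔤
  have := locallyCompactSpace_of_finiteDimensional 𝔤
  have hC := ha.delta2Const_pos hp
  set C := delta2Const (orlicz a)
  have hN : Measurable N.toFun := N.continuous'.measurable
  have hN1 : Measurable fun z : 𝔤 × 𝔤 => N.toFun z.1 := hN.comp measurable_fst
  have hN2 : Measurable fun z : 𝔤 × 𝔤 => N.toFun z.2 := hN.comp measurable_snd
  -- If `‖y⁻¹·x‖ ≥ 2 + 3‖x‖`, the triangle inequality gives `‖y‖ ≥ 2 + 2‖x‖`, so `(x, y)` lies in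
  -- the region `A` below. The tail is thus an exterior of a ball in `w`, as polar coordinates
  -- require.
  let ρ : 𝔤 → ℝ := fun x => 2 + 3 * N.toFun x
  have hρ0 : ∀ x, 0 < ρ x := fun x => by have := N.nonneg' x; simp only [ρ]; positivity
  let G := farKernel N (orlicz a) s u ρ
  have hG : Measurable G := measurable_farKernel N ha hu s (by fun_prop)
  let k : 𝔤 × 𝔤 → ℝ≥0∞ := fun z =>
    fracKernel N (orlicz a) s (u z.1 - u z.2) (S.mul (-z.2) z.1)
  let k₁ : 𝔤 × 𝔤 → ℝ≥0∞ := fun z => fracKernel N (orlicz a) s (u z.1) (S.mul (-z.2) z.1)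
  let k₂ : 𝔤 × 𝔤 → ℝ≥0∞ := fun z => fracKernel N (orlicz a) s (u z.2) (S.mul (-z.2) z.1)
  have hk₁ : Measurable k₁ := by
    have h := (hu.comp measurable_fst).prodMk (measurable_neg_mul S)
    have h' := (measurable_fracKernel N ha s).comp h
    exact h'
  have hk₂ : Measurable k₂ := by
    have h := (hu.comp measurable_snd).prodMk (measurable_neg_mul S)
    have h' := (measurable_fracKernel N ha s).comp h
    exact h'
  let A : Set (𝔤 × 𝔤) := {z | 2 ≤ N.toFun z.2 ∧ 2 * N.toFun z.1 < N.toFun z.2}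
  let B : Set (𝔤 × 𝔤) := {z | 2 ≤ N.toFun z.1 ∧ 2 * N.toFun z.2 < N.toFun z.1}
  have hA : MeasurableSet A := (measurableSet_le measurable_const hN2).inter
    (measurableSet_lt (hN1.const_mul 2) hN2)
  have hB : MeasurableSet B := (measurableSet_le measurable_const hN1).inter
    (measurableSet_lt (hN2.const_mul 2) hN1)
  have hAB : Disjoint A B := by
    rw [Set.disjoint_left]
    rintro z ⟨h1, h2⟩ ⟨h3, h4⟩
    linarith
  have htri : ∀ x y, N.toFun y - N.toFun x ≤ N.toFun (S.mul (-y) x) := fun x y =>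
    (le_abs_self _).trans (N.abs_sub_le' x y)
  have htri' : ∀ x y, N.toFun x - N.toFun y ≤ N.toFun (S.mul (-y) x) := fun x y =>
    (neg_sub (N.toFun y) _ ▸ neg_le_abs _).trans (N.abs_sub_le' x y)
  have hfarA : ∫⁻ x, ∫⁻ w, G (x, w) ∂μ ∂μ ≤ ∫⁻ z in A, k₁ z ∂(μ.prod μ) := by
    rw [← lintegral_prod_fst_neg_mul S μ hG, ← lintegral_indicator hA]
    refine lintegral_mono fun z => ?_
    refine Set.indicator_le_indicator_of_subset (f := k₁)
      (s := {z | ρ z.1 ≤ N.toFun (S.mul (-z.2) z.1)}) ?_ (fun _ => zero_le) z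
    intro z (hz : 2 + 3 * N.toFun z.1 ≤ _)
    have h1 := N.le_add' z.1 z.2
    have h2 := N.nonneg' z.1
    exact ⟨by linarith, by linarith⟩
  have hfarB : ∫⁻ x, ∫⁻ w, G (x, w) ∂μ ∂μ ≤ ∫⁻ z in B, k₂ z ∂(μ.prod μ) := by
    rw [← lintegral_prod_snd_neg_mul S μ hG, ← lintegral_indicator hB]
    refine lintegral_mono fun z => ?_
    refine Set.indicator_le_indicator_of_subset (f := k₂)
      (s := {z | ρ z.2 ≤ N.toFun (S.mul (-z.2) z.1)}) ?_ (fun _ => zero_le) z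
    intro z (hz : 2 + 3 * N.toFun z.2 ≤ _)
    have h1 := N.le_add' z.1 z.2
    have h2 := N.nonneg' z.2
    exact ⟨by linarith, by linarith⟩
  -- The far point `y` is fixed and the near point integrated out; the bound is uniform in `s`.
  have herrA : ∫⁻ z in A, k₂ z ∂(μ.prod μ) ≤ ballMeasure N μ * orliczModular μ (orlicz a) u := by
    rw [← lintegral_indicator hA, lintegral_prod_symm _ (hk₂.indicator hA).aemeasurable,
      orliczModular, ← lintegral_const_mul' _ _ (N.ballMeasure_lt_top μ).ne]
    exact lintegral_mono fun y =>
      lintegral_indicator_fracKernel_le N μ ha hs (u y) y (m := fun x => S.mul (-y) x)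
        fun x => htri x y
  have herrB : ∫⁻ z in B, k₁ z ∂(μ.prod μ) ≤ ballMeasure N μ * orliczModular μ (orlicz a) u := by
    rw [← lintegral_indicator hB, lintegral_prod _ (hk₁.indicator hB).aemeasurable,
      orliczModular, ← lintegral_const_mul' _ _ (N.ballMeasure_lt_top μ).ne]
    exact lintegral_mono fun x =>
      lintegral_indicator_fracKernel_le N μ ha hs (u x) x (m := fun y => S.mul (-y) x)
        fun y => htri' x y
  have hkA : ENNReal.ofReal (2 / C) * ∫⁻ z in A, k₁ z ∂(μ.prod μ) ≤
      ∫⁻ z in A, k z ∂(μ.prod μ) + ∫⁻ z in A, k₂ z ∂(μ.prod μ) := by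
    rw [← lintegral_const_mul' _ _ ENNReal.ofReal_ne_top, ← lintegral_add_right _ hk₂]
    exact lintegral_mono fun z => mul_fracKernel_le N ha hp s _ _ _
  have hkB : ENNReal.ofReal (2 / C) * ∫⁻ z in B, k₂ z ∂(μ.prod μ) ≤
      ∫⁻ z in B, k z ∂(μ.prod μ) + ∫⁻ z in B, k₁ z ∂(μ.prod μ) := by
    rw [← lintegral_const_mul' _ _ ENNReal.ofReal_ne_top, ← lintegral_add_right _ hk₁]
    refine lintegral_mono fun z => ?_
    simp only [k, fracKernel_sub_comm N (orlicz a) s (u z.1)]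
    exact mul_fracKernel_le N ha hp s _ _ _
  have hk : ∫⁻ z in A, k z ∂(μ.prod μ) + ∫⁻ z in B, k z ∂(μ.prod μ) ≤
      fracModular N μ (orlicz a) s u := by
    rw [← lintegral_union hB hAB]
    exact setLIntegral_le_lintegral _ _
  set X := ∫⁻ x, ∫⁻ w, G (x, w) ∂μ ∂μ
  have hsum : ENNReal.ofReal (4 / C) * X ≤ fracModular N μ (orlicz a) s u +
      2 * (ballMeasure N μ * orliczModular μ (orlicz a) u) := by
    have h4 : ENNReal.ofReal (4 / C) = ENNReal.ofReal (2 / C) + ENNReal.ofReal (2 / C) := by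
      rw [← ENNReal.ofReal_add (by positivity) (by positivity)]
      congr 1
      ring
    rw [h4, add_mul, two_mul]
    calc _ ≤ (∫⁻ z in A, k z ∂(μ.prod μ) + ballMeasure N μ * orliczModular μ (orlicz a) u) +
          (∫⁻ z in B, k z ∂(μ.prod μ) + ballMeasure N μ * orliczModular μ (orlicz a) u) :=
          add_le_add ((mul_le_mul_right hfarA _).trans (hkA.trans (by gcongr)))
            ((mul_le_mul_right hfarB _).trans (hkB.trans (by gcongr)))
      _ = (∫⁻ z in A, k z ∂(μ.prod μ) + ∫⁻ z in B, k z ∂(μ.prod μ)) + _ :=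
          add_add_add_comm _ _ _ _
      _ ≤ _ := by gcongr
  have hfar := le_mul_lintegral_farKernel N μ ha (u := u) hpp hp hs hρ0
  rw [mul_assoc, ← mul_add]
  calc _ ≤ ENNReal.ofReal (4 / C) * (ENNReal.ofReal s * X) := mul_le_mul_right hfar _
    _ = ENNReal.ofReal s * (ENNReal.ofReal (4 / C) * X) := by ring
    _ ≤ _ := mul_le_mul_right hsum _

/-! ### Passage to the limit. -/

omit [FiniteDimensional ℝ 𝔤] [IsTopologicalAddGroup 𝔤] [ContinuousSMul ℝ 𝔤] [T2Space 𝔤]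
  [μ.IsAddHaarMeasure] in
include ha hu in
theorem tendsto_lintegral_orlicz_div_rpow (hfin : orliczModular μ (orlicz a) u < ∞) :
    Tendsto (fun s : ℝ => ∫⁻ x, ENNReal.ofReal (orlicz a (|u x| / (2 + 3 * N.toFun x) ^ s)) ∂μ)
      (𝓝[>] 0) (𝓝 (orliczModular μ (orlicz a) u)) := by
  have hρ1 : ∀ x, 1 ≤ 2 + 3 * N.toFun x := fun x => by linarith [N.nonneg' x]
  have hρ0 : ∀ x, 0 < 2 + 3 * N.toFun x := fun x => by linarith [hρ1 x]
  -- Since `2 + 3‖x‖ ≥ 1`, the integrable function `φ(|u|)` dominates for every `s > 0`.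
  refine tendsto_lintegral_filter_of_dominated_convergence
    (fun x => ENNReal.ofReal (orlicz a |u x|)) ?_ ?_ hfin.ne ?_
  · refine Eventually.of_forall fun s => ENNReal.measurable_ofReal.comp ?_
    refine ha.measurable_orlicz_comp (f := fun x => |u x| / (2 + 3 * N.toFun x) ^ s) ?_
      fun x => div_nonneg (abs_nonneg _) (Real.rpow_nonneg (hρ0 x).le s)
    exact (measurable_norm.comp hu).div
      (((N.continuous'.measurable.const_mul 3).const_add 2).pow_const s)
  · filter_upwards [self_mem_nhdsWithin] with s hs
    refine Eventually.of_forall fun x => ENNReal.ofReal_le_ofReal (ha.orlicz_mono ?_ ?_)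
    · exact div_nonneg (abs_nonneg _) (Real.rpow_nonneg (hρ0 x).le s)
    · exact div_le_self (abs_nonneg _) (Real.one_le_rpow (hρ1 x) (le_of_lt hs))
  · refine Eventually.of_forall fun x => ENNReal.tendsto_ofReal ?_
    have hcont : Continuous fun s : ℝ => |u x| / (2 + 3 * N.toFun x) ^ s :=
      continuous_const.div (continuous_const.rpow continuous_id fun _ => Or.inl (hρ0 x).ne')
        fun s => (Real.rpow_pos_of_pos (hρ0 x) s).ne'
    have h := ((ha.continuous_orlicz_comp hcont fun s =>
      div_nonneg (abs_nonneg _) (Real.rpow_nonneg (hρ0 x).le s)).tendsto 0).mono_left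
        (nhdsWithin_le_nhds (s := Set.Ioi 0))
    simpa using h

theorem orliczModular_congr {X : Type*} [MeasurableSpace X] (μ : Measure X) {φ : ℝ → ℝ} {u v : X → ℝ}
    (h : u =ᵐ[μ] v) :
    orliczModular μ φ u = orliczModular μ φ v :=
  lintegral_congr_ae (h.mono fun x hx => by simp only [hx])

omit [BorelSpace 𝔤] [μ.IsAddHaarMeasure] in
theorem fracModular_congr {φ : ℝ → ℝ} {s : ℝ} {u v : 𝔤 → ℝ} (h : u =ᵐ[μ] v) :
    fracModular N μ φ s u = fracModular N μ φ s v := by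
  have := secondCountableTopology_of_finiteDimensional 𝔤
  have := locallyCompactSpace_of_finiteDimensional 𝔤
  refine lintegral_congr_ae ?_
  filter_upwards [Measure.quasiMeasurePreserving_fst.ae_eq_comp h,
    Measure.quasiMeasurePreserving_snd.ae_eq_comp h] with z h1 h2
  simp only [Function.comp_apply] at h1 h2
  simp only [h1, h2]

theorem tendsto_ofReal_mul_nhdsGT {K : ℝ≥0∞} (hK : K ≠ ∞) :
    Tendsto (fun s : ℝ => ENNReal.ofReal s * K) (𝓝[>] 0) (𝓝 0) := by
  have h : Tendsto ENNReal.ofReal (𝓝[>] 0) (𝓝 0) := by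
    simpa using (ENNReal.continuous_ofReal.tendsto 0).mono_left
      (nhdsWithin_le_nhds (s := Set.Ioi 0))
  simpa using ENNReal.Tendsto.mul_const h (Or.inr hK)

include ha hu in
theorem limsup_mul_fracModular_le {pm pp : ℝ} (hpm : 0 < pm)
    (hm : ∀ t : ℝ, 0 < t → pm ≤ t * a t / orlicz a t)
    (hp : ∀ t : ℝ, 0 < t → t * a t / orlicz a t ≤ pp) {s₀ : ℝ} (hs₀ : 0 < s₀)
    (hfin : fracModular N μ (orlicz a) s₀ u < ∞) :
    limsup (fun s => ENNReal.ofReal s * fracModular N μ (orlicz a) s u) (𝓝[>] 0) ≤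
      ENNReal.ofReal (delta2Const (orlicz a)) *
          ((S.homDim : ℝ≥0∞) * ballMeasure N μ / ENNReal.ofReal pm) *
          orliczModular μ (orlicz a) u := by
  have ht := (tendsto_ofReal_mul_nhdsGT hfin.ne).add_const
    (ENNReal.ofReal (delta2Const (orlicz a)) *
          ((S.homDim : ℝ≥0∞) * ballMeasure N μ / ENNReal.ofReal pm) *
          orliczModular μ (orlicz a) u)
  rw [zero_add] at ht
  rw [← ht.limsup_eq]
  refine limsup_le_limsup ?_
  filter_upwards [Ioc_mem_nhdsGT hs₀] with s hs
  exact mul_fracModular_le N μ ha hu hpm hm hp hs.1 hs.2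

include ha hu in
theorem le_liminf_mul_fracModular {pp : ℝ} (hpp : 0 < pp)
    (hp : ∀ t : ℝ, 0 < t → t * a t / orlicz a t ≤ pp)
    (hfin : orliczModular μ (orlicz a) u < ∞) :
    ENNReal.ofReal (4 / delta2Const (orlicz a)) *
        ((S.homDim : ℝ≥0∞) * ballMeasure N μ / ENNReal.ofReal pp) *
          orliczModular μ (orlicz a) u ≤
      liminf (fun s => ENNReal.ofReal s * fracModular N μ (orlicz a) s u) (𝓝[>] 0) := by
  have hK : 2 * (ballMeasure N μ * orliczModular μ (orlicz a) u) ≠ ∞ :=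
    ENNReal.mul_ne_top ENNReal.ofNat_ne_top
      (ENNReal.mul_ne_top (N.ballMeasure_lt_top μ).ne hfin.ne)
  have hM : ENNReal.ofReal (4 / delta2Const (orlicz a)) *
        ((S.homDim : ℝ≥0∞) * ballMeasure N μ / ENNReal.ofReal pp) ≠ ∞ :=
    ENNReal.mul_ne_top ENNReal.ofReal_ne_top (homDim_mul_ballMeasure_div_ne_top N μ hpp)
  -- The error is subtracted with truncation in `[0, ∞]`; the limit is unaffected because the error
  -- tends to `0`.
  have ht := ENNReal.Tendsto.sub
    (ENNReal.Tendsto.const_mul (tendsto_lintegral_orlicz_div_rpow N μ ha hu hfin) (Or.inr hM))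
    (tendsto_ofReal_mul_nhdsGT hK) (Or.inr ENNReal.zero_ne_top)
  rw [tsub_zero] at ht
  rw [← ht.liminf_eq]
  refine liminf_le_liminf ?_
  filter_upwards [self_mem_nhdsWithin] with s hs
  rw [tsub_le_iff_right]
  exact le_mul_fracModular_add N μ ha hu hpp hp hs

end Carnot

end

theorem theorem1p2 {𝔤 : Type*} [LieRing 𝔤] [LieAlgebra ℝ 𝔤] [FiniteDimensional ℝ 𝔤]
    [TopologicalSpace 𝔤] [IsTopologicalAddGroup 𝔤] [ContinuousSMul ℝ 𝔤] [T2Space 𝔤]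
    [MeasurableSpace 𝔤] [BorelSpace 𝔤]
    (S : Carnot.Stratification 𝔤) (N : S.HomogeneousNorm)
    (μ : Measure 𝔤) [μ.IsAddHaarMeasure]
    (a : ℝ → ℝ) (ha : IsOrliczDensity a) (pm pp : ℝ) (hpm : 1 < pm)
    (hL : ∀ t : ℝ, 0 < t → pm ≤ t * a t / orlicz a t ∧ t * a t / orlicz a t ≤ pp)
    (u : 𝔤 → ℝ) (hu : u ∈ ⋃ s ∈ Set.Ioo (0 : ℝ) 1, Carnot.fracSpace N μ (orlicz a) s) :
    let C : ℝ := delta2Const (orlicz a)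
    let QCb : ℝ≥0∞ := (S.homDim : ℝ≥0∞) * Carnot.ballMeasure N μ
    let Φ : ℝ≥0∞ := Carnot.orliczModular μ (orlicz a) u
    let F : ℝ → ℝ≥0∞ := fun s => ENNReal.ofReal s * Carnot.fracModular N μ (orlicz a) s u
    (ENNReal.ofReal (4 / C) * (QCb / ENNReal.ofReal pp) * Φ ≤ liminf F (𝓝[>] 0) ∧
      liminf F (𝓝[>] 0) ≤ limsup F (𝓝[>] 0) ∧
      limsup F (𝓝[>] 0) ≤ ENNReal.ofReal C * (QCb / ENNReal.ofReal pm) * Φ) ∧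
    ∀ L : ℝ≥0∞, Tendsto F (𝓝[>] 0) (𝓝 L) →
      ENNReal.ofReal (4 / C) * (QCb / ENNReal.ofReal pp) * Φ ≤ L ∧
        L ≤ ENNReal.ofReal C * (QCb / ENNReal.ofReal pm) * Φ := by
  intro C QCb Φ F
  obtain ⟨s₀, hs₀, hu, hΦ, hfin⟩ : ∃ s ∈ Set.Ioo (0 : ℝ) 1,
      u ∈ Carnot.fracSpace N μ (orlicz a) s := by simpa using hu
  have hm : ∀ t : ℝ, 0 < t → pm ≤ t * a t / orlicz a t := fun t ht => (hL t ht).1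
  have hp : ∀ t : ℝ, 0 < t → t * a t / orlicz a t ≤ pp := fun t ht => (hL t ht).2
  have hpm0 : 0 < pm := one_pos.trans hpm
  have hpp0 : 0 < pp := hpm0.trans_le ((hm 1 one_pos).trans (hp 1 one_pos))
  -- Membership gives only almost-everywhere measurability. Both modulars ignore null sets, so a
  -- measurable representative can replace `u`.
  have hae := hu.ae_eq_mk
  have hΦ' : Φ = Carnot.orliczModular μ (orlicz a) (hu.mk u) := Carnot.orliczModular_congr μ hae
  have hF : F = fun s => ENNReal.ofReal s * Carnot.fracModular N μ (orlicz a) s (hu.mk u) := by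
    funext s
    simp only [F, Carnot.fracModular_congr N μ hae]
  rw [Carnot.orliczModular_congr μ hae] at hΦ
  rw [Carnot.fracModular_congr N μ hae] at hfin
  have lower : ENNReal.ofReal (4 / C) * (QCb / ENNReal.ofReal pp) * Φ ≤ liminf F (𝓝[>] 0) := by
    rw [hF, hΦ']
    exact Carnot.le_liminf_mul_fracModular N μ ha hu.measurable_mk hpp0 hp hΦ
  have upper : limsup F (𝓝[>] 0) ≤ ENNReal.ofReal C * (QCb / ENNReal.ofReal pm) * Φ := by
    rw [hF, hΦ']
    exact Carnot.limsup_mul_fracModular_le N μ ha hu.measurable_mk hpm0 hm hp hs₀.1 hfin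
  refine ⟨⟨lower, liminf_le_limsup, upper⟩, fun L hLim => ⟨?_, ?_⟩⟩
  · rwa [hLim.liminf_eq] at lower
  · rwa [hLim.limsup_eq] at upper
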